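/- **Setting.** Consider the single-input single-output closed loop $r_I \to e \to K \to q \to R \to v \to C \to u \to P \to y$, $e=r_I-y$, where $K,C,P$ are finite-dimensional linear time-invariant (state-space) blocks and $R$ is a reset element $$\dot x=A_Rx+B_Rq,\qquad v=C_Rx+D_Rq,\qquad x(t^+)=A_\rho\, x(t)\ \text{ whenever } q(t)=0 ,$$ with locally finitely many resets and $x(t)$ the state just before a reset. Put $G=PC$, $R_L(s)=C_R(sI-A_R)^{-1}B_R+D_R$, $S_L=(1+GR_LK)^{-1}$, $R_\delta(s)=C_R(sI-A_R)^{-1}(A_\rho-I)$, $Q_\delta=KS_LGR_\delta$ and $H(s)=(sI-A_R)^{-1}(A_\rho-I)-(sI-A_R)^{-1}B_RQ_\delta(s)$. Let $(A_Q,B_Q,C_Q)$ and $(A_H,B_H,C_H)$ be state-space matrices of $Q_\delta$ and $H$ with $A_Q,A_H$ Hurwitz. Let $\omega>0$ and let the reference be $r_I(t)=|R_I|\sin(\omega t+\angle R_I)$, $0\ne R_I\in\mathbb C$. Put $\kappa=K(j\omega)S_L(j\omega)R_I$. The $n$-th harmonic ($n\ge1$) of a $2\pi/\omega$-periodic signal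 $f$ is the phasor $F_n=\frac{j\omega}{\pi}\int_0^{2\pi/\omega}f(t)e^{-jn\omega t}\,dt$, so that $f(t)\sim F_0+\sum_{n\ge1}|F_n|\sin(n\omega t+\angle F_n)$. The $n$-th harmonic sensitivity $S_n(\omega)$, complementary sensitivity $T_n(\omega)$ and control sensitivity $CS_n(\omega)$ are the $n$-th harmonics of $e$, $y$ and $u$, respectively, in the steady state for the reference $\sin\omega t$. **The formulas.** For a state vector $x$ let $$\Sigma_Q=\sum_{p\in\{2,4,\dots\}}\bigl(e^{A_Qp\pi/\omega}-e^{A_Q(p-1)\pi/\omega}\bigr),\quad \Sigma_H=\sum_{p\in\{2,4,\dots\}}\bigl(e^{A_Hp\pi/\omega}-e^{A_H(p-1)\pi/\omega}\bigr),\quad \Phi(x)=\sin^{-1}\!\bigl(C_Q\Sigma_QB_Q\,x\,|\kappa|^{-1}\bigr),$$ $$\Lambda=\omega^2I+A_R^2,\quad \hat x=\bigl[I+\Lambda^{-1}A_RB_RC_Q\Sigma_QB_Q-C_H\Sigma_HB_H\bigr]^{-1}\Lambda^{-1}\omega B_R|\kappa| ,$$ $$\Delta=I+e^{\pi A_R/\omega},\quad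 \Delta_D=I+A_\rho e^{\pi A_R/\omega},\quad \Theta_D=-\tfrac{2\omega^2}{\pi}\Delta\bigl(\Delta_D^{-1}A_\rho\Delta\Lambda^{-1}-\Lambda^{-1}\bigr),\quad B^\star(x)=\frac{1}{\omega|\kappa|}\Lambda\Delta^{-1}(I+e^{\pi A_R/\omega}A_\rho)x ,$$ $R^\star_{DF,n}(\omega,B)=C_R(jn\omega I-A_R)^{-1}j\Theta_DB$ for odd $n$ and $0$ for even $n$, $\Psi_n(x)=|\kappa|e^{nj(\angle\kappa+\Phi(x))}$, and $$W_n(x)=S_L(jn\omega)G(jn\omega)R^\star_{DF,n}(\omega,B^\star(x))\Psi_n(x),\qquad \mathcal E_n(x)=\begin{cases}S_L(j\omega)R_I-W_1(x),&n=1,\\-W_n(x),&n>1.\end{cases}$$ **Assumptions.** The loop is well posed ($1+K(\infty)R_L(\infty)C(\infty)P(\infty)\neq0$); no $jn\omega$, $n\ge1$, is an eigenvalue of the state matrices of $K,R,C,P$ or a zero of $1+GR_LK$; $\Delta$, $\Delta_D$ and the bracket in $\hat x$ are invertible; the loop has a unique $2\pi/\omega$-periodic (steady-state) response to $r_I$,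 and in it: (i) there are exactly two resets per period; (ii) at every reset the left derivative of $q$ has the sign of $\dot q_L$, $q_L(t)=|\kappa|\sin(\omega t+\angle\kappa)$; (iii) at every reset the absolute value of the combined impulse responses $\sum_{t_r<t}C_Qe^{A_Q(t-t_r)}B_Qx(t_r)$ of all prior resets is less than $|\kappa|$. **Conclusion.** A reset at which $q$ descends exists. At every such reset $t^\downarrow$, with $x^\downarrow=x(t^\downarrow)$, one has $x^\downarrow=\cos\bigl(\Phi(x^\downarrow)\bigr)\hat x$, and for all $n\ge1$ the $n$-th harmonic of $e$ is $E_n=\mathcal E_n(x^\downarrow)$ and $$S_n=E_n\bigl(|R_I|e^{nj\angle R_I}\bigr)^{-1},\qquad T_n=I_n-E_n\bigl(|R_I|e^{nj\angle R_I}\bigr)^{-1},\qquad CS_n=P^{-1}(jn\omega)\,T_n\ \text{ if }P(jn\omega)\ne0,$$ where $I_1=1$ and $I_n=0$ for $n>1$ are the harmonics of the identity. Moreover the fully analytical solution $E_{\delta\text{-}CL,n}=\mathcal E_n(\hat x)$ is correct to second order in $\Phi=\Phi(\hat x)$: with $\varepsilon_n=|W_n(\hat x)|\,\tfrac12\bigl(\Phi^2+n|\Phi|^3\bigr)$,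 for all $n\ge1$, $$|E_n-E_{\delta\text{-}CL,n}|\le\varepsilon_n,\quad \bigl|S_n-E_{\delta\text{-}CL,n}(|R_I|e^{nj\angle R_I})^{-1}\bigr|\le\frac{\varepsilon_n}{|R_I|},\quad \bigl|T_n-\bigl(I_n-E_{\delta\text{-}CL,n}(|R_I|e^{nj\angle R_I})^{-1}\bigr)\bigr|\le\frac{\varepsilon_n}{|R_I|},$$ $$\bigl|CS_n-P^{-1}(jn\omega)\bigl(I_n-E_{\delta\text{-}CL,n}(|R_I|e^{nj\angle R_I})^{-1}\bigr)\bigr|\le\frac{\varepsilon_n}{|R_I|\,|P(jn\omega)|}\ \text{ if }P(jn\omega)\neq0 .$$ -/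

import Mathlib

open Set Filter Topology

noncomputable section

namespace ResetControl

/-- Entrywise inclusion of a real matrix into the complex matrices. -/
abbrev toC {m n : Type*} (M : Matrix m n ℝ) : Matrix m n ℂ := M.map Complex.ofReal

/-- All eigenvalues of the real matrix `A` have negative real part. -/
def Hurwitz {σ : Type*} [Fintype σ] [DecidableEq σ] (A : Matrix σ σ ℝ) : Prop :=
  ∀ μ ∈ spectrum ℂ (toC A), μ.re < 0

/-! ### Single-input single-output linear blocks -/

/-- A real SISO state-space block `x' = A x + B w`, output `C x + D w`. -/
structure Block (ι : Type*) where
  A : Matrix ι ι ℝ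
  B : ι → ℝ
  C : ι → ℝ
  D : ℝ

namespace Block

variable {ι : Type*} [Fintype ι]

/-- Right-hand side of the state equation. -/
def vel (S : Block ι) (x : ι → ℝ) (w : ℝ) : ι → ℝ := S.A.mulVec x + w • S.B

/-- Output equation. -/
def out (S : Block ι) (x : ι → ℝ) (w : ℝ) : ℝ := S.C ⬝ᵥ x + S.D * w

variable [DecidableEq ι]

/-- `s` is not an eigenvalue of the state matrix, so that the transfer function is defined. -/
def RegularAt (S : Block ι) (s : ℂ) : Prop := IsUnit (s • (1 : Matrix ι ι ℂ) - toC S.A).det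

/-- The resolvent `(sI - A)⁻¹`. -/
def res (S : Block ι) (s : ℂ) : Matrix ι ι ℂ := (s • (1 : Matrix ι ι ℂ) - toC S.A)⁻¹

/-- The transfer function `C (sI - A)⁻¹ B + D`. -/
def tf (S : Block ι) (s : ℂ) : ℂ :=
  (fun i => (S.C i : ℂ)) ⬝ᵥ (S.res s).mulVec (fun i => (S.B i : ℂ)) + S.D

end Block

/-! ### Strictly proper multivariable realizations -/

/-- State-space matrices `(A, B, C)`, without feed-through, with `n` inputs and `m` outputs. -/
structure Realization (σ m n : Type*) where
  A : Matrix σ σ ℝ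
  B : Matrix σ n ℝ
  C : Matrix m σ ℝ

namespace Realization

variable {σ m n : Type*} [Fintype σ] [DecidableEq σ]

/-- The transfer matrix `C (sI - A)⁻¹ B`. -/
def tf (S : Realization σ m n) (s : ℂ) : Matrix m n ℂ :=
  toC S.C * (s • (1 : Matrix σ σ ℂ) - toC S.A)⁻¹ * toC S.B

/-- The impulse response `C e^{tA} B`. -/
def impulse (S : Realization σ m n) (t : ℝ) : Matrix m n ℝ :=
  S.C * NormedSpace.exp (t • S.A) * S.B

/-- `C (∑_{p = 2, 4, 6, …} (e^{A pπ/ω} - e^{A (p-1)π/ω})) B`; here `p = 2 (k + 1)`. -/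
def altSum (S : Realization σ m n) (ω : ℝ) : Matrix m n ℝ :=
  S.C * (∑' k : ℕ, (NormedSpace.exp (((2 * k + 2 : ℝ) * Real.pi / ω) • S.A)
    - NormedSpace.exp (((2 * k + 1 : ℝ) * Real.pi / ω) • S.A))) * S.B

end Realization

/-! ### The closed loop

`r_I → (+) → e → K → q → R → v → C → u → P → y`, with `e = r_I - y`. The block `R` is the reset
element: its state is multiplied by `Aρ` whenever `q = 0`. The linear part behind the reset element
is `G = P C`. -/

/-- A SISO reset control loop. -/
structure Loop (k r c p : Type*) where
  K : Block k
  R : Block r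
  Aρ : Matrix r r ℝ
  C : Block c
  P : Block p

/-- The state trajectories and the signals of a loop. -/
@[ext] structure Signals (k r c p : Type*) where
  xK : ℝ → k → ℝ
  xR : ℝ → r → ℝ
  xC : ℝ → c → ℝ
  xP : ℝ → p → ℝ
  e : ℝ → ℝ
  q : ℝ → ℝ
  v : ℝ → ℝ
  u : ℝ → ℝ
  y : ℝ → ℝ

/-- The sinusoid `|R| sin (ω t + ∠R)` with phasor `R`. -/
def sinusoid (ω : ℝ) (R : ℂ) (t : ℝ) : ℝ := ‖R‖ * Real.sin (ω * t + R.arg)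

/-- The `n`-th harmonic phasor `F_n`, `n ≥ 1`, of a `2π/ω`-periodic signal `f`, in the convention
`f(t) = F_0 + ∑_{n ≥ 1} |F_n| sin (n ω t + ∠F_n)`: it is `2 j` times the usual complex Fourier
coefficient, so that `sinusoid ω R` has first phasor `R`. -/
def harmonic (ω : ℝ) (n : ℕ) (f : ℝ → ℝ) : ℂ :=
  (Complex.I * ω / Real.pi) *
    ∫ t in (0 : ℝ)..(2 * Real.pi / ω), (f t : ℂ) * Complex.exp (-(Complex.I * n * ω * t))

namespace Loop

variable {k r c p : Type*} [Fintype k] [Fintype r] [Fintype c] [Fintype p]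

/-- `z` is a response of the closed loop to the reference `ref`, on the whole time axis. States are
left-continuous: `z.xR t` at a reset instant `t` is the state just before the reset. -/
structure IsResponse (L : Loop k r c p) (ref : ℝ → ℝ) (z : Signals k r c p) : Prop where
  e_eq : ∀ t, z.e t = ref t - z.y t
  q_eq : ∀ t, z.q t = L.K.out (z.xK t) (z.e t)
  v_eq : ∀ t, z.v t = L.R.out (z.xR t) (z.q t)
  u_eq : ∀ t, z.u t = L.C.out (z.xC t) (z.v t)
  y_eq : ∀ t, z.y t = L.P.out (z.xP t) (z.u t)
  left_K : ∀ t, HasDerivWithinAt z.xK (L.K.vel (z.xK t) (z.e t)) (Iic t) t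
  left_R : ∀ t, HasDerivWithinAt z.xR (L.R.vel (z.xR t) (z.q t)) (Iic t) t
  left_C : ∀ t, HasDerivWithinAt z.xC (L.C.vel (z.xC t) (z.v t)) (Iic t) t
  left_P : ∀ t, HasDerivWithinAt z.xP (L.P.vel (z.xP t) (z.u t)) (Iic t) t
  flow_K : ∀ t, z.q t ≠ 0 → HasDerivAt z.xK (L.K.vel (z.xK t) (z.e t)) t
  flow_R : ∀ t, z.q t ≠ 0 → HasDerivAt z.xR (L.R.vel (z.xR t) (z.q t)) t
  flow_C : ∀ t, z.q t ≠ 0 → HasDerivAt z.xC (L.C.vel (z.xC t) (z.v t)) t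
  flow_P : ∀ t, z.q t ≠ 0 → HasDerivAt z.xP (L.P.vel (z.xP t) (z.u t)) t
  cont_K : Continuous z.xK
  cont_C : Continuous z.xC
  cont_P : Continuous z.xP
  reset : ∀ t, z.q t = 0 → Tendsto z.xR (𝓝[>] t) (𝓝 (L.Aρ.mulVec (z.xR t)))
  resets_finite : ∀ a b : ℝ, {t ∈ Icc a b | z.q t = 0}.Finite

/-- `z` is a steady-state response, i.e. a response with the period of the reference, to the
sinusoidal reference with frequency `ω` and phasor `RI`. -/
structure IsSteadyState (L : Loop k r c p) (ω : ℝ) (RI : ℂ) (z : Signals k r c p) : Prop where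
  response : L.IsResponse (sinusoid ω RI) z
  periodic_K : Function.Periodic z.xK (2 * Real.pi / ω)
  periodic_R : Function.Periodic z.xR (2 * Real.pi / ω)
  periodic_C : Function.Periodic z.xC (2 * Real.pi / ω)
  periodic_P : Function.Periodic z.xP (2 * Real.pi / ω)

open Classical in
/-- The steady-state response of a loop that has one (only used where it is unique; the zero signals
otherwise). -/
def steadyState (L : Loop k r c p) (ω : ℝ) (RI : ℂ) : Signals k r c p :=
  if h : ∃ z, L.IsSteadyState ω RI z then h.choose else ⟨0, 0, 0, 0, 0, 0, 0, 0, 0⟩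

/-- `n`-th harmonic sensitivity `S_n(ω)`: the `n`-th harmonic of the error in the steady state for the
unit reference `sin (ω t)`. -/
def sensitivity (L : Loop k r c p) (ω : ℝ) (n : ℕ) : ℂ := harmonic ω n (L.steadyState ω 1).e

/-- `n`-th harmonic complementary sensitivity `T_n(ω)`, from the reference to the output `y`. -/
def compSensitivity (L : Loop k r c p) (ω : ℝ) (n : ℕ) : ℂ := harmonic ω n (L.steadyState ω 1).y

/-- `n`-th harmonic control sensitivity `CS_n(ω)`, from the reference to the control input `u`. -/
def controlSensitivity (L : Loop k r c p) (ω : ℝ) (n : ℕ) : ℂ :=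
  harmonic ω n (L.steadyState ω 1).u

/-- The algebraic loop through the feed-through terms can be solved. -/
def WellPosed (L : Loop k r c p) : Prop := 1 + L.K.D * L.R.D * L.C.D * L.P.D ≠ 0

/-- `t` is a reset instant at a descending zero crossing of `q`. -/
def IsDescendingReset (z : Signals k r c p) (t : ℝ) : Prop :=
  z.q t = 0 ∧ derivWithin z.q (Iic t) t < 0

variable [DecidableEq k] [DecidableEq r] [DecidableEq c] [DecidableEq p]

/-! #### Base linear system (the loop without resets) -/

/-- `G(s) = P(s) C(s)`. -/
def G (L : Loop k r c p) (s : ℂ) : ℂ := L.P.tf s * L.C.tf s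

/-- Base linear sensitivity `S_L(s) = (1 + G(s) R_L(s) K(s))⁻¹`. -/
def SL (L : Loop k r c p) (s : ℂ) : ℂ := (1 + L.G s * L.R.tf s * L.K.tf s)⁻¹

/-- None of the transfer functions of the loop, nor `S_L`, has a pole at `s`. -/
def RegularAt (L : Loop k r c p) (s : ℂ) : Prop :=
  L.K.RegularAt s ∧ L.R.RegularAt s ∧ L.C.RegularAt s ∧ L.P.RegularAt s ∧
    1 + L.G s * L.R.tf s * L.K.tf s ≠ 0

/-- The phasor `K(jω) S_L(jω) R_I(jω)` of `q` in the base linear system. -/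
def KSR (L : Loop k r c p) (ω : ℝ) (RI : ℂ) : ℂ :=
  L.K.tf (Complex.I * ω) * L.SL (Complex.I * ω) * RI

/-! #### Response to reset impulses -/

/-- `R^X_δ(s) = (sI - A_R)⁻¹ (Aρ - I)`: a reset at `t_r` adds `(Aρ - I) x(t_r)` to the state. -/
def RXδ (L : Loop k r c p) (s : ℂ) : Matrix r r ℂ := L.R.res s * toC (L.Aρ - 1)

/-- `R_δ(s) = C_R R^X_δ(s)`, a row. -/
def Rδ (L : Loop k r c p) (s : ℂ) : Matrix Unit r ℂ :=
  Matrix.replicateRow Unit (fun i => (L.R.C i : ℂ)) * L.RXδ s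

/-- `Q_δ(s) = K(s) S_L(s) G(s) R_δ(s)`. -/
def Qδ (L : Loop k r c p) (s : ℂ) : Matrix Unit r ℂ := (L.K.tf s * L.SL s * L.G s) • L.Rδ s

/-- `H(s) = R^X_δ(s) - R^X_L(s) K(s) S_L(s) G(s) R_δ(s)`, with `R^X_L(s) = (sI - A_R)⁻¹ B_R`. -/
def H (L : Loop k r c p) (s : ℂ) : Matrix r r ℂ :=
  L.RXδ s - L.R.res s * Matrix.replicateCol Unit (fun i => (L.R.B i : ℂ)) * L.Qδ s

/-- `S` consists of state-space matrices of the transfer matrix `F` built from the loop: the two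
agree wherever they are both defined. -/
def Realizes {σ m n : Type*} [Fintype σ] [DecidableEq σ] (L : Loop k r c p)
    (S : Realization σ m n) (F : ℂ → Matrix m n ℂ) : Prop :=
  ∀ s : ℂ, L.RegularAt s → s ∉ spectrum ℂ (toC S.A) → S.tf s = F s

variable {σ τ : Type*} [Fintype σ] [DecidableEq σ] [Fintype τ] [DecidableEq τ]

/-- `Φ(ω, x)`, the phase shift of the zero crossings caused by the resets. -/
def Φ (L : Loop k r c p) (SQ : Realization σ Unit r) (ω : ℝ) (RI : ℂ) (x : r → ℝ) : ℝ :=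
  Real.arcsin ((SQ.altSum ω).mulVec x () * ‖L.KSR ω RI‖⁻¹)

/-- `Λ(ω) = ω² I + A_R²`. -/
def Lam (L : Loop k r c p) (ω : ℝ) : Matrix r r ℝ := ω ^ 2 • (1 : Matrix r r ℝ) + L.R.A ^ 2

/-- The matrix whose inverse occurs in the formula for the reset states. -/
def resetMatrix (L : Loop k r c p) (SQ : Realization σ Unit r) (SH : Realization τ r r) (ω : ℝ) :
    Matrix r r ℝ :=
  1 + (L.Lam ω)⁻¹ * L.R.A * Matrix.replicateCol Unit L.R.B * SQ.altSum ω - SH.altSum ω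

/-- The analytical reset state: `resetMatrix⁻¹ (ω² I + A_R²)⁻¹ ω B_R |K S_L R_I|`. -/
def resetState (L : Loop k r c p) (SQ : Realization σ Unit r) (SH : Realization τ r r) (ω : ℝ)
    (RI : ℂ) : r → ℝ :=
  ‖L.KSR ω RI‖ • ((L.resetMatrix SQ SH ω)⁻¹ * (L.Lam ω)⁻¹).mulVec (ω • L.R.B)

/-! #### Higher-order sinusoidal-input describing functions of the reset element -/

/-- `e^{π A_R / ω}`. -/
def expHalf (L : Loop k r c p) (ω : ℝ) : Matrix r r ℝ := NormedSpace.exp ((Real.pi / ω) • L.R.A)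

/-- `Δ(ω) = I + e^{π A_R / ω}`. -/
def Del (L : Loop k r c p) (ω : ℝ) : Matrix r r ℝ := 1 + L.expHalf ω

/-- `Δ_D(ω) = I + Aρ e^{π A_R / ω}`. -/
def DelD (L : Loop k r c p) (ω : ℝ) : Matrix r r ℝ := 1 + L.Aρ * L.expHalf ω

/-- `Γ_D(ω) = Δ_D⁻¹ Aρ Δ Λ⁻¹`. -/
def GamD (L : Loop k r c p) (ω : ℝ) : Matrix r r ℝ :=
  (L.DelD ω)⁻¹ * L.Aρ * L.Del ω * (L.Lam ω)⁻¹

/-- `Θ_D(ω) = -(2ω²/π) Δ (Γ_D - Λ⁻¹)`. -/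
def ThetaD (L : Loop k r c p) (ω : ℝ) : Matrix r r ℝ :=
  (-(2 * ω ^ 2 / Real.pi)) • (L.Del ω * (L.GamD ω - (L.Lam ω)⁻¹))

/-- The virtual input matrix `B⋆(ω, x)`: the one for which the reset element
`(A_R, B⋆, C_R, Aρ)`, driven in open loop by a sinusoid with the amplitude `|K S_L R_I|`, is in the
state `x` at the resets at descending zero crossings. -/
def Bstar (L : Loop k r c p) (ω : ℝ) (RI : ℂ) (x : r → ℝ) : r → ℝ :=
  (ω * ‖L.KSR ω RI‖)⁻¹ • (L.Lam ω * (L.Del ω)⁻¹ * (1 + L.expHalf ω * L.Aρ)).mulVec x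

/-- `R⋆_{DF,n}(ω, B)`: the reset-induced part of the `n`-th describing function of the reset element
with input matrix `B`, `C_R (jnωI - A_R)⁻¹ jΘ_D(ω) B` for odd `n` and `0` for even `n`. -/
def RstarDF (L : Loop k r c p) (ω : ℝ) (n : ℕ) (B : r → ℝ) : ℂ :=
  if Odd n then
    (fun i => (L.R.C i : ℂ)) ⬝ᵥ
      (L.R.res (Complex.I * n * ω) * (Complex.I • toC (L.ThetaD ω))).mulVec (fun i => (B i : ℂ))
  else 0

/-- `Ψ(ω, n) = |K S_L R_I| exp (nj∠(K S_L R_I) + njΦ(ω, x))`. -/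
def Psi (L : Loop k r c p) (SQ : Realization σ Unit r) (ω : ℝ) (RI : ℂ) (x : r → ℝ) (n : ℕ) : ℂ :=
  (‖L.KSR ω RI‖ : ℂ) *
    Complex.exp (Complex.I * n * ((L.KSR ω RI).arg + L.Φ SQ ω RI x : ℝ))

/-- The reset-induced part `S_L(nω) G(nω) R⋆_{DF,n}(ω, B⋆(ω, x)) Ψ(ω, n)` of the error response. -/
def resetPart (L : Loop k r c p) (SQ : Realization σ Unit r) (ω : ℝ) (RI : ℂ) (x : r → ℝ) (n : ℕ) :
    ℂ :=
  L.SL (Complex.I * n * ω) *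
    (L.G (Complex.I * n * ω) * L.RstarDF ω n (L.Bstar ω RI x) * L.Psi SQ ω RI x n)

/-- The analytical error response `E_n(ω)`, as a function of the reset state `x`. -/
def errorResponse (L : Loop k r c p) (SQ : Realization σ Unit r) (ω : ℝ) (RI : ℂ) (x : r → ℝ)
    (n : ℕ) : ℂ :=
  if n = 1 then L.SL (Complex.I * ω) * RI - L.resetPart SQ ω RI x 1
  else - L.resetPart SQ ω RI x n

end Loop

/-- The harmonic reference phasor `|R_I| exp (nj∠R_I)`. -/
def refPhasor (RI : ℂ) (n : ℕ) : ℂ :=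
  (‖RI‖ : ℂ) * Complex.exp (Complex.I * n * RI.arg)

/-- The `n`-th harmonic of the identity map: the identity for `n = 1`, zero for `n > 1`. -/
def idHarmonic (n : ℕ) : ℂ := if n = 1 then 1 else 0

end ResetControl

end

noncomputable section

namespace ResetControl

/-! The loop is not linear, but its responses may be scaled by nonzero constants and shifted in
time. Since a half-period shift negates the reference, uniqueness of the steady state gives
half-wave symmetry, `f (t + π/ω) = -f t` for every signal. With two resets per period, the resets
are then exactly half a period apart and the reset states alternate in sign
(`exists_eq_sub_of_zero`).

Let `a` be a reset, `x₀` the state just before it, and `b = a + π/ω`. On `[a, b]` the loop is linear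
and time-invariant. Integrate its equations against `e^{-st}` with `s = jnω`, `n` odd. Then `e^{-sb}
= -e^{-sa}`, so the boundary terms of `K`, `C`, `P` cancel, while the reset element leaves the jump
`e^{-sa} (Aρ - 1) x₀`. Solving the resulting scalar equations (`Loop.IsHalfPeriod.expCoeff_eq`)
yields every odd harmonic in terms of `a` and `x₀`; the even ones vanish by symmetry.

To find `a` and `x₀`, compare `q` and the reset state with the sinusoidal base response plus the
stable response to an alternating impulse train. All odd coefficients agree, so the continuous
functions agree on `[a, b]` (`eq_zero_of_odd_coefficients_eq_zero`). Evaluation at `b` gives two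
equations (`Loop.IsHalfPeriod.reset_equations`): the first fixes the sine of the phase `θ = ωa + ∠κ`
as `sin Φ(x₀)`, and a descending crossing selects `cos θ = -cos Φ(x₀)`. The second is then linear in
`x₀`, with solution `cos Φ(x₀) • x̂`. The matrix `B⋆` is built so that `Θ_D B⋆(x₀)` is a multiple of
the jump `(Aρ - 1) x₀`, which turns the harmonics into the stated formula.

For the approximation, put `φ = Φ(x₀)` and let `s` be the argument of the arcsine in `Φ(x̂)`.
Linearity gives `sin φ = s cos φ`, so `φ = arctan s` against `Φ(x̂) = arcsin s`. The reset parts at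
`x₀` and `x̂` differ by the factors `cos φ e^{jnφ}` and `e^{jnΦ(x̂)}`, and
`norm_cos_mul_exp_sub_exp_le` bounds the distance of these. -/

/-! ### Scalar estimates comparing arcsine and arctangent -/

theorem sub_cube_le_arctan_sin {φ : ℝ} (h0 : 0 ≤ φ) (h1 : φ ≤ Real.pi / 2) :
    φ - φ ^ 3 / 2 ≤ Real.arctan (Real.sin φ) := by
  have hd : ∀ x : ℝ, HasDerivAt (fun x => Real.arctan (Real.sin x) - (x - x ^ 3 / 2))
      (1 / (1 + Real.sin x ^ 2) * Real.cos x - (1 - (3 * x ^ 2) / 2)) x := by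
    intro x
    have h2 := ((hasDerivAt_id x).sub (((hasDerivAt_id x).pow 3).div_const 2))
    convert! (Real.hasDerivAt_sin x).arctan.sub h2 using 1
    simp
  have hm : MonotoneOn (fun x => Real.arctan (Real.sin x) - (x - x ^ 3 / 2))
      (Icc 0 (Real.pi / 2)) := by
    refine monotoneOn_of_deriv_nonneg (convex_Icc _ _)
      (fun x _ => (hd x).continuousAt.continuousWithinAt)
      (fun x _ => (hd x).differentiableAt.differentiableWithinAt) fun x hx => ?_
    rw [interior_Icc] at hx
    -- The claim follows from `(1 - 3x²/2)(1 + x²) ≤ 1 - x²/2 ≤ cos x` together with `sin² x ≤ x²`.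
    rw [(hd x).deriv, sub_nonneg, one_div, inv_mul_eq_div, le_div_iff₀ (by positivity)]
    have hc : 0 ≤ Real.cos x := Real.cos_nonneg_of_mem_Icc ⟨by linarith [hx.1, hx.2], hx.2.le⟩
    have hc' := Real.one_sub_sq_div_two_le_cos (x := x)
    have hs : Real.sin x ^ 2 ≤ x ^ 2 := by
      have h3 : Real.sin x ≤ x := Real.sin_le hx.1.le
      have h4 : 0 ≤ Real.sin x :=
        Real.sin_nonneg_of_nonneg_of_le_pi hx.1.le (by linarith [hx.2, hx.1])
      gcongr
    rcases le_total (1 - 3 * x ^ 2 / 2) 0 with h | h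
    · nlinarith [sq_nonneg (Real.sin x)]
    · nlinarith [mul_le_mul_of_nonneg_left hs h, sq_nonneg (x ^ 2), sq_nonneg x]
  have := hm ⟨le_rfl, by positivity⟩ ⟨h0, h1⟩ h0
  simp only [Real.sin_zero, Real.arctan_zero] at this
  linarith

/-- Both functions are odd, so `0 ≤ s` suffices. There the preceding bound applies at `φ = arcsin
s`, and `arctan s = arcsin (s / √(1 + s²))` gives the order. -/
theorem abs_arcsin_sub_arctan_le {s : ℝ} (h : |s| ≤ 1) :
    |Real.arcsin s - Real.arctan s| ≤ |Real.arcsin s| ^ 3 / 2 ∧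
      |Real.arctan s| ≤ |Real.arcsin s| := by
  have key : ∀ s : ℝ, 0 ≤ s → s ≤ 1 →
      |Real.arcsin s - Real.arctan s| ≤ |Real.arcsin s| ^ 3 / 2 ∧
      |Real.arctan s| ≤ |Real.arcsin s| := by
    intro s h0 h1
    have ha : 0 ≤ Real.arcsin s := Real.arcsin_nonneg.2 h0
    have hb : 0 ≤ Real.arctan s := Real.arctan_nonneg.2 h0
    have h2 := sub_cube_le_arctan_sin ha (Real.arcsin_le_pi_div_two s)
    rw [Real.sin_arcsin (by linarith) h1] at h2
    have h3 : Real.arctan s ≤ Real.arcsin s := by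
      rw [Real.arctan_eq_arcsin]
      refine Real.monotone_arcsin (div_le_self h0 ?_)
      rw [Real.le_sqrt' one_pos]
      nlinarith
    rw [abs_of_nonneg ha, abs_of_nonneg hb, abs_of_nonneg (sub_nonneg.2 h3)]
    exact ⟨by linarith, h3⟩
  rcases le_total 0 s with h0 | h0
  · exact key s h0 (by rwa [abs_of_nonneg h0] at h)
  · have := key (-s) (by linarith) (by rwa [abs_of_nonpos h0] at h)
    rw [Real.arcsin_neg, Real.arctan_neg, abs_neg, abs_neg, ← neg_sub',
      abs_neg] at this
    exact this

/-- The amplitude factor `cos φ` costs `φ²/2`, and the phase error `arcsin s - arctan s` is cubic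
and multiplied by `n`. -/
theorem norm_cos_mul_exp_sub_exp_le {s φ : ℝ} (hφ : Real.tan φ = s) (h1 : -(Real.pi / 2) < φ)
    (h2 : φ < Real.pi / 2) {n : ℕ} (hn : 1 ≤ n) :
    ‖(Real.cos φ : ℂ) * Complex.exp (Complex.I * n * φ) -
      Complex.exp (Complex.I * n * Real.arcsin s)‖ ≤
      (Real.arcsin s ^ 2 + n * |Real.arcsin s| ^ 3) / 2 := by
  have hφ' : φ = Real.arctan s := by rw [← hφ, Real.arctan_tan h1 h2]
  have he : ∀ x : ℝ, ‖Complex.exp (Complex.I * n * x)‖ = 1 := fun x => by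
    rw [show Complex.I * n * x = ((n * x : ℝ) : ℂ) * Complex.I by push_cast; ring]
    exact Complex.norm_exp_ofReal_mul_I _
  have hc0 : 0 < Real.cos φ := Real.cos_pos_of_mem_Ioo ⟨h1, h2⟩
  rcases le_total |s| 1 with hs | hs
  · obtain ⟨hA, hB⟩ := abs_arcsin_sub_arctan_le hs
    rw [← hφ'] at hA hB
    have e1 : ‖(Real.cos φ : ℂ) * Complex.exp (Complex.I * n * φ) -
        Complex.exp (Complex.I * n * φ)‖ ≤ φ ^ 2 / 2 := by
      rw [← sub_one_mul, norm_mul, he, mul_one, ← Complex.ofReal_one, ← Complex.ofReal_sub,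
        Complex.norm_real, Real.norm_eq_abs, abs_sub_comm, abs_of_nonneg
        (sub_nonneg.2 (Real.cos_le_one φ))]
      linarith [Real.one_sub_sq_div_two_le_cos (x := φ)]
    have e2 : ‖Complex.exp (Complex.I * n * φ) - Complex.exp (Complex.I * n * Real.arcsin s)‖ ≤
        n * |Real.arcsin s - φ| := by
      have : Complex.exp (Complex.I * n * φ) - Complex.exp (Complex.I * n * Real.arcsin s) =
          Complex.exp (Complex.I * n * Real.arcsin s) *
            (Complex.exp (Complex.I * (n * (φ - Real.arcsin s) : ℝ)) - 1) := by
        rw [mul_sub, ← Complex.exp_add]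
        push_cast
        ring_nf
      rw [this, norm_mul, he, one_mul]
      refine (Real.norm_exp_I_mul_ofReal_sub_one_le).trans ?_
      rw [Real.norm_eq_abs, abs_mul, Nat.abs_cast, abs_sub_comm]
    have e3 : φ ^ 2 ≤ Real.arcsin s ^ 2 := sq_le_sq.2 hB
    have e4 : (n : ℝ) * |Real.arcsin s - φ| ≤ n * (|Real.arcsin s| ^ 3 / 2) := by gcongr
    refine (norm_sub_le_norm_sub_add_norm_sub _ (Complex.exp (Complex.I * n * φ)) _).trans ?_
    linarith
  -- Outside `[-1, 1]` the arcsine is clamped at `±π/2`, and the trivial bound `2` is already below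
  -- the right-hand side.
  · have hφ2 : |Real.arcsin s| = Real.pi / 2 := by
      rcases le_abs.1 hs with h | h
      · rw [Real.arcsin_of_one_le h, abs_of_nonneg (by positivity)]
      · rw [Real.arcsin_of_le_neg_one (by linarith), abs_neg, abs_of_nonneg (by positivity)]
    have h3 : ‖(Real.cos φ : ℂ) * Complex.exp (Complex.I * n * φ) -
        Complex.exp (Complex.I * n * Real.arcsin s)‖ ≤ 2 := by
      refine (norm_sub_le _ _).trans ?_
      rw [norm_mul, he, he, Complex.norm_real, Real.norm_eq_abs, abs_of_pos hc0]
      linarith [Real.cos_le_one φ]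
    refine h3.trans ?_
    rw [← sq_abs, hφ2]
    have h4 : (1 : ℝ) ≤ n := by exact_mod_cast hn
    have h5 := Real.pi_gt_three
    have h6 : (3 / 2 : ℝ) ^ 2 ≤ (Real.pi / 2) ^ 2 := by gcongr
    have h7 : (3 / 2 : ℝ) ^ 3 ≤ (Real.pi / 2) ^ 3 := by gcongr
    nlinarith

/-! ### Uniqueness from odd Fourier coefficients -/

/-- A continuous function on a half-period without odd harmonics vanishes. -/
theorem eq_zero_of_odd_coefficients_eq_zero {ω a : ℝ} (hω : 0 < ω) {f : ℝ → ℝ}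
    (hf : ContinuousOn f (Icc a (a + Real.pi / ω)))
    (h : ∀ n : ℕ, Odd n → ∫ t in a..(a + Real.pi / ω),
      (f t : ℂ) * Complex.exp (-(Complex.I * n * ω * t)) = 0) :
    ∀ t ∈ Icc a (a + Real.pi / ω), f t = 0 := by
  have hp : 0 < Real.pi / ω := by positivity
  have hab : a < a + Real.pi / ω := by linarith
  set b := a + Real.pi / ω with hb
  have hba : b - a = Real.pi / ω := by rw [hb]; ring
  -- all odd integer harmonics vanish
  have hz : ∀ m : ℤ, Odd m → ∫ t in a..b,
      (f t : ℂ) * Complex.exp (-(Complex.I * m * ω * t)) = 0 := by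
    intro m hm
    rcases le_total 0 m with h0 | h0
    · have := h m.toNat (by rcases hm with ⟨k, hk⟩; exact ⟨k.toNat, by omega⟩)
      rw [← this]
      have hc : ((m.toNat : ℕ) : ℂ) = m := by exact_mod_cast Int.toNat_of_nonneg h0
      simp only [hc]
    · have := h (-m).toNat (by rcases hm with ⟨k, hk⟩; exact ⟨(-k - 1).toNat, by omega⟩)
      have hc : (((-m).toNat : ℕ) : ℂ) = -m := by
        exact_mod_cast Int.toNat_of_nonneg (by omega : 0 ≤ -m)
      rw [hc] at this
      -- Since `f` is real, conjugation carries positive frequencies to negative ones.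
      have h2 := congrArg (starRingEnd ℂ) this
      rw [map_zero, ← intervalIntegral.intervalIntegral_conj] at h2
      rw [← h2]
      congr! 2 with t
      rw [map_mul, Complex.conj_ofReal, ← Complex.exp_conj]
      simp
  -- This modulation moves the odd frequencies `(2i + 1)ω` to `2iω`, the full Fourier system of an
  -- interval of length `π/ω`, so that Parseval applies.
  set g : ℝ → ℂ := fun t => (f t : ℂ) * Complex.exp (-(Complex.I * ω * t)) with hg
  have hgc : ContinuousOn g (Icc a b) :=
    (Complex.continuous_ofReal.comp_continuousOn hf).mul (by fun_prop)
  have hL2 : MeasureTheory.MemLp g 2 (MeasureTheory.volume.restrict (Ioc a b)) := by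
    obtain ⟨C, hC⟩ := isCompact_Icc.exists_bound_of_continuousOn hgc
    refine MeasureTheory.MemLp.of_bound
      ((hgc.mono Ioc_subset_Icc_self).aestronglyMeasurable measurableSet_Ioc) C ?_
    filter_upwards [MeasureTheory.ae_restrict_mem measurableSet_Ioc] with t ht
    exact hC t (Ioc_subset_Icc_self ht)
  have hcoef : ∀ i : ℤ, fourierCoeffOn hab g i = 0 := by
    intro i
    rw [fourierCoeffOn_eq_integral]
    have := hz (2 * i + 1) ⟨i, rfl⟩
    rw [show (∫ x in a..b, (fourier (-i)) (x : AddCircle (b - a)) • g x) = 0 from ?_, smul_zero]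
    rw [← this]
    congr! 2 with t
    rw [fourier_coe_apply, hg, smul_eq_mul, mul_left_comm, ← Complex.exp_add, hba]
    congr 2
    have : (ω : ℂ) ≠ 0 := by exact_mod_cast hω.ne'
    have hpi : (Real.pi : ℂ) ≠ 0 := by exact_mod_cast Real.pi_ne_zero
    push_cast
    field_simp
    ring
  have hP := tsum_sq_fourierCoeffOn hab hL2
  simp only [hcoef, norm_zero, ne_eq, OfNat.ofNat_ne_zero, not_false_eq_true, zero_pow,
    tsum_zero] at hP
  have hI : ∫ x in a..b, ‖g x‖ ^ 2 = 0 := by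
    rcases smul_eq_zero.1 hP.symm with h1 | h1
    · exact absurd h1 (inv_ne_zero (by linarith))
    · exact h1
  have hgn : ∀ t, ‖g t‖ ^ 2 = f t ^ 2 := by
    intro t
    rw [hg]
    simp only [norm_mul, Complex.norm_real, Real.norm_eq_abs]
    rw [show -(Complex.I * ω * t) = ((-(ω * t) : ℝ) : ℂ) * Complex.I by push_cast; ring,
      Complex.norm_exp_ofReal_mul_I, mul_one, sq_abs]
  simp only [hgn] at hI
  intro t ht
  by_contra hne
  have : 0 < ∫ x in a..b, f x ^ 2 :=
    intervalIntegral.integral_pos hab (hf.pow 2) (fun x _ => sq_nonneg _)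
      ⟨t, ht, by positivity⟩
  linarith

/-! ### Exponentials of Hurwitz matrices and alternating series -/

section Exponential

attribute [local instance] Matrix.linftyOpNormedRing Matrix.linftyOpNormedAlgebra
  Matrix.linftyOpNormedAddCommGroup Matrix.linftyOpNormedSpace

variable {σ : Type*} [Fintype σ] [DecidableEq σ]

theorem toC_exp (A : Matrix σ σ ℝ) : toC (NormedSpace.exp A) = NormedSpace.exp (toC A) := by
  have := NormedSpace.map_exp (Complex.ofRealHom.mapMatrix (m := σ)) (by
    change Continuous fun A : Matrix σ σ ℝ => A.map Complex.ofReal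
    exact continuous_id.matrix_map Complex.continuous_ofReal) A
  exact this

/-- The spectral mapping theorem for the exponential of a complex matrix (one inclusion). -/
theorem exists_exp_eq_of_mem_spectrum_exp {A : Matrix σ σ ℂ} {μ : ℂ}
    (hμ : μ ∈ spectrum ℂ (NormedSpace.exp A)) : ∃ l ∈ spectrum ℂ A, μ = Complex.exp l := by
  set F := Matrix.toLin' (NormedSpace.exp A) with hF
  set f := Matrix.toLin' A with hf
  have hev : Module.End.HasEigenvalue F μ := by
    rw [Module.End.hasEigenvalue_iff_mem_spectrum, Matrix.spectrum_toLin']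
    exact hμ
  -- By commutation the `μ`-eigenspace of `e^A` is invariant under `A`, hence contains an
  -- eigenvector of `A`; on it the exponential series sums to `e^l`.
  have hcomm : Commute f F := by
    have h1 : Commute A (NormedSpace.exp A) := (Commute.refl A).exp_right
    change f * F = F * f
    rw [hf, hF, Module.End.mul_eq_comp, Module.End.mul_eq_comp, ← Matrix.toLin'_mul,
      ← Matrix.toLin'_mul, h1.eq]
  have hmaps : MapsTo f (Module.End.eigenspace F μ) (Module.End.eigenspace F μ) :=
    Module.End.mapsTo_genEigenspace_of_comm hcomm.symm μ 1
  have : Nontrivial (Module.End.eigenspace F μ) := Submodule.nontrivial_iff_ne_bot.2 hev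
  obtain ⟨l, hl⟩ := Module.End.exists_eigenvalue (f.restrict hmaps)
  obtain ⟨v, hv⟩ := hl.exists_hasEigenvector
  have hv0 : (v : σ → ℂ) ≠ 0 := fun h => hv.2 (Subtype.ext h)
  have hfv : f v = l • (v : σ → ℂ) := by
    exact congrArg Subtype.val hv.apply_eq_smul
  have hFv : F v = μ • (v : σ → ℂ) := Module.End.mem_eigenspace_iff.1 v.2
  refine ⟨l, ?_, ?_⟩
  · rw [← Matrix.spectrum_toLin', ← Module.End.hasEigenvalue_iff_mem_spectrum]
    exact Module.End.hasEigenvalue_of_hasEigenvector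
      ⟨Module.End.mem_eigenspace_iff.2 hfv, hv0⟩
  · have hpow : ∀ n : ℕ, (A ^ n).mulVec (v : σ → ℂ) = l ^ n • (v : σ → ℂ) := by
      intro n
      induction n with
      | zero => simp
      | succ n ih =>
        rw [pow_succ', ← Matrix.mulVec_mulVec, ih, Matrix.mulVec_smul]
        rw [hf, Matrix.toLin'_apply] at hfv
        rw [hfv, smul_smul, pow_succ]
    have hsum := NormedSpace.exp_series_hasSum_exp' (𝕂 := ℂ) A
    let T : Matrix σ σ ℂ →ₗ[ℂ] (σ → ℂ) :=
      { toFun := fun B => B.mulVec (v : σ → ℂ)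
        map_add' := fun B C => Matrix.add_mulVec B C _
        map_smul' := fun c B => Matrix.smul_mulVec c B _ }
    have hT := hsum.mapL (LinearMap.toContinuousLinearMap T)
    have h1 : (fun n : ℕ => (LinearMap.toContinuousLinearMap T) ((n.factorial⁻¹ : ℂ) • A ^ n)) =
        fun n : ℕ => ((n.factorial⁻¹ : ℂ) • l ^ n) • (v : σ → ℂ) := by
      funext n
      change ((n.factorial⁻¹ : ℂ) • A ^ n).mulVec (v : σ → ℂ) = _
      rw [Matrix.smul_mulVec, hpow, smul_assoc]
    rw [h1] at hT
    have h2 := (NormedSpace.exp_series_hasSum_exp' (𝕂 := ℂ) l).smul_const (v : σ → ℂ)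
    have h3 := hT.unique h2
    rw [← Complex.exp_eq_exp_ℂ] at h3
    have h4 : μ • (v : σ → ℂ) = Complex.exp l • (v : σ → ℂ) := by
      rw [← hFv, ← h3]
      rfl
    exact smul_left_injective ℂ hv0 h4

/-- By Gelfand's formula `‖M ^ n‖ ≤ r ^ n` eventually, for some `r < 1` above the spectral radius.
-/
theorem summable_norm_pow_of_spectrum_lt_one {M : Matrix σ σ ℂ}
    (h : ∀ μ ∈ spectrum ℂ M, ‖μ‖ < 1) : Summable fun m : ℕ => ‖M ^ m‖ := by
  cases isEmpty_or_nonempty σ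
  · have : ∀ m : ℕ, ‖M ^ m‖ = 0 := fun m => by rw [Subsingleton.elim (M ^ m) 0, norm_zero]
    simp only [this, summable_zero]
  have hr : spectralRadius ℂ M < (1 : NNReal) :=
    spectrum.spectralRadius_lt_of_forall_lt M fun z hz => by exact_mod_cast h z hz
  obtain ⟨r, hr1, hr2⟩ := ENNReal.lt_iff_exists_nnreal_btwn.1 hr
  have hev :=
    (spectrum.pow_nnnorm_pow_one_div_tendsto_nhds_spectralRadius M).eventually_lt_const hr1
  refine Summable.of_norm_bounded_eventually_nat (g := fun n => (r : ℝ) ^ n)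
    (summable_geometric_of_lt_one r.2 (by exact_mod_cast hr2)) ?_
  filter_upwards [hev, eventually_gt_atTop 0] with n hn hn0
  rw [norm_norm]
  have h1 := ENNReal.rpow_le_rpow hn.le (Nat.cast_nonneg n : (0 : ℝ) ≤ n)
  rw [← ENNReal.rpow_mul, one_div, inv_mul_cancel₀ (by exact_mod_cast hn0.ne'), ENNReal.rpow_one,
    ENNReal.rpow_natCast] at h1
  exact_mod_cast h1

/-- The eigenvalues of `e^{hA}` have the form `e^{hl}` with `l` an eigenvalue of `A`, so their
moduli `e^{h Re l}` are below one. -/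
theorem Hurwitz.summable_norm_pow_exp {A : Matrix σ σ ℝ} (hA : Hurwitz A) {h : ℝ} (hh : 0 < h) :
    Summable fun m : ℕ => ‖(toC (NormedSpace.exp (h • A))) ^ m‖ := by
  refine summable_norm_pow_of_spectrum_lt_one fun μ hμ => ?_
  rw [toC_exp] at hμ
  obtain ⟨l, hl, rfl⟩ := exists_exp_eq_of_mem_spectrum_exp hμ
  have hs : toC (h • A) = (h : ℂ) • toC A := by ext i j; simp
  have hu : IsUnit (h : ℂ) := by rw [isUnit_iff_ne_zero]; exact_mod_cast hh.ne'
  rw [hs, show (h : ℂ) • toC A = hu.unit • toC A from rfl, spectrum.unit_smul_eq_smul] at hl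
  obtain ⟨l', hl', rfl⟩ := hl
  rw [Complex.norm_exp, Real.exp_lt_one_iff]
  change ((h : ℂ) * l').re < 0
  rw [Complex.re_ofReal_mul]
  exact mul_neg_of_pos_of_neg hh (hA l' hl')

theorem Hurwitz.summable_neg_pow_exp {A : Matrix σ σ ℝ} (hA : Hurwitz A) {h : ℝ} (hh : 0 < h) :
    Summable fun m : ℕ => (-NormedSpace.exp (h • A)) ^ m := by
  have h1 : Summable fun m : ℕ => (-(toC (NormedSpace.exp (h • A)))) ^ m := by
    refine Summable.of_norm ((hA.summable_norm_pow_exp hh).congr fun m => ?_)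
    rw [neg_pow, (Commute.neg_one_left _).pow_left m |>.eq]
    rcases Nat.even_or_odd m with hm | hm <;> simp [hm]
  refine Pi.summable.2 fun i => Pi.summable.2 fun j => ?_
  have h3 : Summable fun m : ℕ => ((-(toC (NormedSpace.exp (h • A)))) ^ m) i j :=
    Pi.summable.1 (Pi.summable.1 h1 i) j
  rw [← Complex.summable_ofReal]
  refine h3.congr fun m => ?_
  have : toC ((-NormedSpace.exp (h • A)) ^ m) = (-(toC (NormedSpace.exp (h • A)))) ^ m := by
    have := map_pow (Complex.ofRealHom.mapMatrix (m := σ)) (-NormedSpace.exp (h • A)) m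
    rw [map_neg] at this
    exact this
  rw [← this]
  rfl

/-- Neumann series: the alternating sum is the inverse of `1 + e^{hA}`. -/
theorem Hurwitz.one_add_mul_tsum {A : Matrix σ σ ℝ} (hA : Hurwitz A) {h : ℝ} (hh : 0 < h) :
    (1 + NormedSpace.exp (h • A)) * ∑' m : ℕ, (-NormedSpace.exp (h • A)) ^ m = 1 := by
  have := (hA.summable_neg_pow_exp hh).one_sub_mul_tsum_pow
  rwa [sub_neg_eq_add] at this

theorem exp_nat_mul_smul (A : Matrix σ σ ℝ) (m : ℕ) (h : ℝ) :
    NormedSpace.exp ((m * h) • A) = NormedSpace.exp (h • A) ^ m := by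
  rw [mul_smul, Nat.cast_smul_eq_nsmul, Matrix.exp_nsmul]

theorem hasDerivAt_exp_sub_smul_mulVec (A : Matrix σ σ ℝ) (a : ℝ) (w : σ → ℝ) (t : ℝ) :
    HasDerivAt (fun t : ℝ => (NormedSpace.exp ((t - a) • A)).mulVec w)
      (A.mulVec ((NormedSpace.exp ((t - a) • A)).mulVec w)) t := by
  let T : Matrix σ σ ℝ →ₗ[ℝ] (σ → ℝ) :=
    { toFun := fun B => B.mulVec w
      map_add' := fun B C => Matrix.add_mulVec B C _
      map_smul' := fun c B => Matrix.smul_mulVec c B _ }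
  have h1 := (hasDerivAt_exp_smul_const' (𝕂 := ℝ) A (t - a)).comp_sub_const t a
  have h2 := (LinearMap.toContinuousLinearMap T).hasFDerivAt.comp_hasDerivAt t h1
  rw [Matrix.mulVec_mulVec]
  exact h2

variable {m n : Type*}

theorem hasSum_neg_pow_succ {M : Matrix σ σ ℝ} (hM : Summable fun m : ℕ => (-M) ^ m) :
    HasSum (fun l : ℕ => (-M) ^ (l + 1)) (-(M * ∑' m : ℕ, (-M) ^ m)) := by
  have := hM.hasSum.mul_left (-M)
  rw [neg_mul] at this
  convert! this using 2 with l
  exact pow_succ' _ _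

/-- Consecutive terms of `∑_{l ≥ 1} (-M)^l` are paired; absolute stability of the powers is what
makes regrouping harmless. -/
theorem tsum_pow_even_sub_pow_odd {M : Matrix σ σ ℝ} (hM : Summable fun m : ℕ => (-M) ^ m) :
    ∑' k : ℕ, (M ^ (2 * k + 2) - M ^ (2 * k + 1)) = -(M * ∑' m : ℕ, (-M) ^ m) := by
  have ha := hasSum_neg_pow_succ hM
  have he : Summable fun k : ℕ => (-M) ^ (2 * k + 1) :=
    ha.summable.comp_injective (i := fun k => 2 * k) fun a b => by simp
  have ho : Summable fun k : ℕ => (-M) ^ (2 * k + 1 + 1) :=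
    ha.summable.comp_injective (i := fun k => 2 * k + 1) fun a b => by simp
  rw [← (HasSum.even_add_odd (f := fun l : ℕ => (-M) ^ (l + 1)) he.hasSum ho.hasSum).unique ha,
    ← he.tsum_add ho]
  refine tsum_congr fun k => ?_
  rw [Odd.neg_pow ⟨k, rfl⟩, Even.neg_pow ⟨k + 1, by ring⟩]
  abel

theorem Realization.altSum_eq (S : Realization σ m n) (hS : Hurwitz S.A) {ω : ℝ} (hω : 0 < ω) :
    S.altSum ω = -(S.C * (NormedSpace.exp ((Real.pi / ω) • S.A) *
      ∑' m : ℕ, (-NormedSpace.exp ((Real.pi / ω) • S.A)) ^ m) * S.B) := by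
  have hpos : 0 < Real.pi / ω := by positivity
  rw [Realization.altSum, ← Matrix.neg_mul, ← Matrix.mul_neg,
    ← tsum_pow_even_sub_pow_odd (hS.summable_neg_pow_exp hpos)]
  congr 4
  funext k
  rw [← exp_nat_mul_smul, ← exp_nat_mul_smul]
  push_cast
  simp only [mul_div_assoc]

/-- The alternating sum of the impulse responses at the distances `π/ω, 2π/ω, …`. -/
theorem Realization.hasSum_alternating_impulse (S : Realization σ m n) [Fintype n]
    (hS : Hurwitz S.A) {ω : ℝ} (hω : 0 < ω) (x : n → ℝ) (i : m) :
    HasSum (fun l : ℕ => (S.impulse ((l + 1 : ℕ) * (Real.pi / ω))).mulVec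
      ((-1 : ℝ) ^ (l + 1) • x) i) ((S.altSum ω).mulVec x i) := by
  have hpos : 0 < Real.pi / ω := by positivity
  have ha := hasSum_neg_pow_succ (hS.summable_neg_pow_exp hpos)
  rw [S.altSum_eq hS hω]
  simp only [Realization.impulse, exp_nat_mul_smul]
  generalize NormedSpace.exp ((Real.pi / ω) • S.A) = M at ha ⊢
  generalize ∑' m : ℕ, (-M) ^ m = N at ha ⊢
  let T : Matrix σ σ ℝ →ₗ[ℝ] ℝ :=
    { toFun := fun X => (S.C * X * S.B).mulVec x i
      map_add' := fun X Y => by rw [Matrix.mul_add, Matrix.add_mul, Matrix.add_mulVec]; rfl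
      map_smul' := fun c X => by
        rw [Matrix.mul_smul, Matrix.smul_mul, Matrix.smul_mulVec]; rfl }
  have hT := ha.mapL (LinearMap.toContinuousLinearMap T)
  have h1 : (fun l : ℕ => (S.C * M ^ (l + 1) * S.B).mulVec ((-1 : ℝ) ^ (l + 1) • x) i) =
      fun l : ℕ => (LinearMap.toContinuousLinearMap T) ((-M) ^ (l + 1)) := by
    funext l
    change _ = (S.C * (-M) ^ (l + 1) * S.B).mulVec x i
    rcases Nat.even_or_odd (l + 1) with hl | hl <;>
      simp [hl.neg_pow, Matrix.mulVec_neg, Matrix.neg_mulVec]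
  rw [h1]
  convert! hT using 1
  change _ = (S.C * (-(M * N)) * S.B).mulVec x i
  rw [Matrix.mul_neg, Matrix.neg_mul]

end Exponential

/-! ### Scaling and time shift of responses -/

section Symmetry

variable {k r c p : Type*}

/-- The signals, shifted in time and scaled. -/
def Signals.transform (a τ : ℝ) (z : Signals k r c p) : Signals k r c p where
  xK := fun t => a • z.xK (t + τ)
  xR := fun t => a • z.xR (t + τ)
  xC := fun t => a • z.xC (t + τ)
  xP := fun t => a • z.xP (t + τ)
  e := fun t => a * z.e (t + τ)
  q := fun t => a * z.q (t + τ)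
  v := fun t => a * z.v (t + τ)
  u := fun t => a * z.u (t + τ)
  y := fun t => a * z.y (t + τ)

theorem Signals.transform_transform (a b τ ρ : ℝ) (z : Signals k r c p) :
    (z.transform a τ).transform b ρ = z.transform (b * a) (ρ + τ) := by
  simp only [Signals.transform, smul_smul, mul_assoc, add_assoc]

theorem Signals.transform_one_zero (z : Signals k r c p) : z.transform 1 0 = z := by
  simp [Signals.transform]

variable [Fintype k] [Fintype r] [Fintype c] [Fintype p]

theorem Block.vel_smul {ι : Type*} [Fintype ι] (S : Block ι) (a : ℝ) (x : ι → ℝ) (w : ℝ) :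
    S.vel (a • x) (a * w) = a • S.vel x w := by
  simp [Block.vel, Matrix.mulVec_smul, mul_smul]

theorem Block.out_smul {ι : Type*} [Fintype ι] (S : Block ι) (a : ℝ) (x : ι → ℝ) (w : ℝ) :
    S.out (a • x) (a * w) = a * S.out x w := by
  simp only [Block.out, dotProduct_smul, smul_eq_mul]
  ring

theorem hasDerivWithinAt_smul_shift {ι : Type*} [Fintype ι] {x : ℝ → ι → ℝ} {x' : ι → ℝ}
    (a τ t : ℝ) (h : HasDerivWithinAt x x' (Iic (t + τ)) (t + τ)) :
    HasDerivWithinAt (fun t => a • x (t + τ)) (a • x') (Iic t) t := by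
  have h1 : HasDerivWithinAt (fun t : ℝ => t + τ) 1 (Iic t) t :=
    (hasDerivAt_id t).add_const τ |>.hasDerivWithinAt
  have h2 := h.scomp t h1 (fun s hs => by simpa using hs)
  rw [one_smul] at h2
  exact h2.const_smul a

/-- Flow and reset map are linear and time-invariant, and a nonzero factor does not change where `q`
vanishes. Sums of responses are not covered, because the reset instants depend on `q`. -/
theorem Loop.IsResponse.transform {L : Loop k r c p} {ref : ℝ → ℝ} {z : Signals k r c p}
    (hz : L.IsResponse ref z) {a : ℝ} (ha : a ≠ 0) (τ : ℝ) :
    L.IsResponse (fun t => a * ref (t + τ)) (z.transform a τ) where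
  e_eq t := by simp only [Signals.transform, hz.e_eq, mul_sub]
  q_eq t := by simp only [Signals.transform, hz.q_eq, Block.out_smul]
  v_eq t := by simp only [Signals.transform, hz.v_eq, Block.out_smul]
  u_eq t := by simp only [Signals.transform, hz.u_eq, Block.out_smul]
  y_eq t := by simp only [Signals.transform, hz.y_eq, Block.out_smul]
  left_K t := by
    simpa only [Signals.transform, Block.vel_smul] using
      hasDerivWithinAt_smul_shift a τ t (hz.left_K (t + τ))
  left_R t := by
    simpa only [Signals.transform, Block.vel_smul] using
      hasDerivWithinAt_smul_shift a τ t (hz.left_R (t + τ))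
  left_C t := by
    simpa only [Signals.transform, Block.vel_smul] using
      hasDerivWithinAt_smul_shift a τ t (hz.left_C (t + τ))
  left_P t := by
    simpa only [Signals.transform, Block.vel_smul] using
      hasDerivWithinAt_smul_shift a τ t (hz.left_P (t + τ))
  flow_K t ht := by
    simpa only [Signals.transform, Block.vel_smul] using
      ((hz.flow_K (t + τ) (right_ne_zero_of_mul ht)).comp_add_const t τ).fun_const_smul a
  flow_R t ht := by
    simpa only [Signals.transform, Block.vel_smul] using
      ((hz.flow_R (t + τ) (right_ne_zero_of_mul ht)).comp_add_const t τ).fun_const_smul a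
  flow_C t ht := by
    simpa only [Signals.transform, Block.vel_smul] using
      ((hz.flow_C (t + τ) (right_ne_zero_of_mul ht)).comp_add_const t τ).fun_const_smul a
  flow_P t ht := by
    simpa only [Signals.transform, Block.vel_smul] using
      ((hz.flow_P (t + τ) (right_ne_zero_of_mul ht)).comp_add_const t τ).fun_const_smul a
  cont_K := by
    have := hz.cont_K
    simp only [Signals.transform]
    fun_prop
  cont_C := by
    have := hz.cont_C
    simp only [Signals.transform]
    fun_prop
  cont_P := by
    have := hz.cont_P
    simp only [Signals.transform]
    fun_prop
  reset t ht := by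
    have h0 : z.q (t + τ) = 0 := (mul_eq_zero.1 ht).resolve_left ha
    have h1 : Tendsto (fun s : ℝ => s + τ) (𝓝[>] t) (𝓝[>] (t + τ)) :=
      tendsto_nhdsWithin_iff.2
        ⟨((continuous_id.add continuous_const).tendsto t).mono_left nhdsWithin_le_nhds,
          eventually_nhdsWithin_of_forall fun s hs => by simpa using hs⟩
    have h2 := ((hz.reset _ h0).comp h1).const_smul a
    simp only [Signals.transform, Matrix.mulVec_smul]
    exact h2
  resets_finite b d := by
    refine ((hz.resets_finite (b + τ) (d + τ)).preimage
      ((add_left_injective τ).injOn (s := _))).subset ?_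
    rintro t ⟨ht, h0⟩
    exact ⟨⟨by linarith [ht.1], by linarith [ht.2]⟩, (mul_eq_zero.1 h0).resolve_left ha⟩

theorem Loop.IsSteadyState.transform {L : Loop k r c p} {ω : ℝ} {RI RI' : ℂ}
    {z : Signals k r c p} (hz : L.IsSteadyState ω RI z) {a : ℝ} (ha : a ≠ 0) (τ : ℝ)
    (href : ∀ t, sinusoid ω RI' t = a * sinusoid ω RI (t + τ)) :
    L.IsSteadyState ω RI' (z.transform a τ) where
  response := by
    have h1 := hz.response.transform ha τ
    rwa [← funext href] at h1
  periodic_K t := by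
    simp only [Signals.transform]
    rw [add_right_comm, hz.periodic_K]
  periodic_R t := by
    simp only [Signals.transform]
    rw [add_right_comm, hz.periodic_R]
  periodic_C t := by
    simp only [Signals.transform]
    rw [add_right_comm, hz.periodic_C]
  periodic_P t := by
    simp only [Signals.transform]
    rw [add_right_comm, hz.periodic_P]

/-- A unique steady-state response has half-wave symmetry. -/
theorem Loop.IsSteadyState.transform_neg_one {L : Loop k r c p} {ω : ℝ} (hω : 0 < ω) {RI : ℂ}
    {z : Signals k r c p} (hz : L.IsSteadyState ω RI z)
    (huniq : ∀ z', L.IsSteadyState ω RI z' → z' = z) : z.transform (-1) (Real.pi / ω) = z := by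
  refine huniq _ (hz.transform (by norm_num) _ fun t => ?_)
  rw [sinusoid, sinusoid, show ω * (t + Real.pi / ω) + RI.arg = ω * t + RI.arg + Real.pi by
    field_simp; ring, Real.sin_add_pi]
  ring

/-- The steady-state response to the unit reference in terms of a unique steady-state response to
another reference of the same frequency. -/
theorem Loop.IsSteadyState.steadyState_one {L : Loop k r c p} {ω : ℝ} (hω : 0 < ω) {RI : ℂ}
    (hRI : RI ≠ 0) {z : Signals k r c p} (hz : L.IsSteadyState ω RI z)
    (huniq : ∀ z', L.IsSteadyState ω RI z' → z' = z) :
    L.steadyState ω 1 = z.transform ‖RI‖⁻¹ (-(RI.arg / ω)) := by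
  have hn : ‖RI‖ ≠ 0 := norm_ne_zero_iff.2 hRI
  have hex : ∃ z', L.IsSteadyState ω 1 z' := by
    refine ⟨z.transform ‖RI‖⁻¹ (-(RI.arg / ω)), hz.transform (inv_ne_zero hn) _ fun t => ?_⟩
    rw [sinusoid, sinusoid, show ω * (t + -(RI.arg / ω)) + RI.arg = ω * t by
      field_simp; ring, inv_mul_cancel_left₀ hn]
    simp
  have h1 : L.IsSteadyState ω 1 (L.steadyState ω 1) := by
    rw [Loop.steadyState, dif_pos hex]
    exact hex.choose_spec
  -- The chosen unit response, transformed back, must be `z`; hence the choice in `steadyState` is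
  -- immaterial.
  have h2 := huniq _ (h1.transform hn (RI.arg / ω) fun t => by
    rw [sinusoid, sinusoid, show ω * (t + RI.arg / ω) = ω * t + RI.arg by field_simp]
    simp)
  rw [← h2, Signals.transform_transform, inv_mul_cancel₀ hn, neg_add_cancel,
    Signals.transform_one_zero]

/-- The delay `∠R_I / ω` multiplies the `n`-th coefficient by `e^{-nj∠R_I}`, and periodicity moves
the integration interval back. -/
theorem harmonic_transform {ω : ℝ} (hω : 0 < ω) {RI : ℂ} {f : ℝ → ℝ}
    (hf : Function.Periodic f (2 * Real.pi / ω)) (n : ℕ) :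
    harmonic ω n (fun t => ‖RI‖⁻¹ * f (t + -(RI.arg / ω))) =
      harmonic ω n f * (refPhasor RI n)⁻¹ := by
  have hωc : (ω : ℂ) ≠ 0 := by exact_mod_cast hω.ne'
  set τ := -(RI.arg / ω) with hτ
  have hpi : (Real.pi : ℂ) ≠ 0 := by exact_mod_cast Real.pi_ne_zero
  set g : ℝ → ℂ := fun t => (f t : ℂ) * Complex.exp (-(Complex.I * n * ω * t)) with hg
  have hper : Function.Periodic g (2 * Real.pi / ω) := by
    intro t
    simp only [hg, hf t]
    congr 1
    rw [Complex.exp_eq_exp_iff_exists_int]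
    refine ⟨-n, ?_⟩
    push_cast
    field_simp
    ring
  have hint : ∀ t : ℝ, ((‖RI‖⁻¹ * f (t + τ) : ℝ) : ℂ) * Complex.exp (-(Complex.I * n * ω * t)) =
      (refPhasor RI n)⁻¹ * g (t + τ) := by
    intro t
    have e1 : -(Complex.I * n * ω * t) =
        -(Complex.I * n * ω * (t + τ : ℝ)) + -(Complex.I * n * RI.arg) := by
      rw [hτ]
      push_cast
      field_simp
      ring
    rw [e1, Complex.exp_add, refPhasor, mul_inv, ← Complex.exp_neg, hg]
    push_cast
    ring
  rw [harmonic, harmonic]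
  simp only [hint]
  rw [intervalIntegral.integral_const_mul, intervalIntegral.integral_comp_add_right]
  have := hper.intervalIntegral_add_eq (0 + τ) 0
  rw [show 2 * Real.pi / ω + τ = 0 + τ + 2 * Real.pi / ω by ring, this, zero_add]
  ring

end Symmetry

/-! ### Location of the resets -/

section Zeros

/-- If a half-wave symmetric function has two zeros per period, then two zeros are not closer than
half a period. -/
theorem not_zero_of_ncard_eq_two {q : ℝ → ℝ} {h : ℝ} (hh : 0 < h) (hanti : ∀ t, q (t + h) = -q t)
    (htwo : {t ∈ Ico (0 : ℝ) (2 * h) | q t = 0}.ncard = 2) {a s : ℝ} (ha : q a = 0)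
    (hs : s ∈ Ioo a (a + h)) : q s ≠ 0 := by
  intro h0
  have hper : Function.Periodic q (2 * h) := fun t => by
    rw [two_mul, ← add_assoc, hanti, hanti, neg_neg]
  have h2 : 0 < 2 * h := by linarith
  have hfin : {t ∈ Ico (0 : ℝ) (2 * h) | q t = 0}.Finite :=
    Set.finite_of_ncard_ne_zero (by rw [htwo]; norm_num)
  have hmem : ∀ t, q t = 0 → toIcoMod h2 0 t ∈ {t ∈ Ico (0 : ℝ) (2 * h) | q t = 0} := by
    intro t ht
    refine ⟨by simpa using toIcoMod_mem_Ico h2 0 t, ?_⟩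
    rw [toIcoMod, hper.sub_zsmul_eq, ht]
  have hinj : ∀ t ∈ Ico a (a + 2 * h), ∀ t' ∈ Ico a (a + 2 * h),
      toIcoMod h2 0 t = toIcoMod h2 0 t' → t = t' := by
    intro t ht t' ht' he
    obtain ⟨m, hm⟩ : ∃ m : ℤ, t - t' = m * (2 * h) := by
      refine ⟨toIcoDiv h2 0 t - toIcoDiv h2 0 t', ?_⟩
      rw [toIcoMod, toIcoMod, zsmul_eq_mul, zsmul_eq_mul] at he
      push_cast
      linarith
    have hm1 : (m : ℝ) * (2 * h) < 1 * (2 * h) := by linarith [ht.1, ht.2, ht'.1, ht'.2]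
    have hm2 : (-1 : ℝ) * (2 * h) < m * (2 * h) := by linarith [ht.1, ht.2, ht'.1, ht'.2]
    have h3 := lt_of_mul_lt_mul_right hm1 h2.le
    have h4 := lt_of_mul_lt_mul_right hm2 h2.le
    have h5 : m = 0 := by
      have h6 : m < 1 := by exact_mod_cast h3
      have h7 : -1 < m := by exact_mod_cast h4
      omega
    rw [h5, Int.cast_zero, zero_mul] at hm
    linarith
  -- A zero `s` strictly between `a` and `a + h` would make three zeros in one period, still
  -- distinct after reduction modulo `2h`.
  have hsub : ({toIcoMod h2 0 a, toIcoMod h2 0 s, toIcoMod h2 0 (a + h)} : Set ℝ) ⊆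
      {t ∈ Ico (0 : ℝ) (2 * h) | q t = 0} := by
    rintro t (rfl | rfl | rfl)
    · exact hmem _ ha
    · exact hmem _ h0
    · exact hmem _ (by rw [hanti, ha, neg_zero])
  have hcard := Set.ncard_le_ncard hsub hfin
  have ma : a ∈ Ico a (a + 2 * h) := ⟨le_rfl, by linarith⟩
  have ms : s ∈ Ico a (a + 2 * h) := ⟨hs.1.le, by linarith [hs.2]⟩
  have mb : a + h ∈ Ico a (a + 2 * h) := ⟨by linarith, by linarith⟩
  rw [htwo, Set.ncard_eq_three.2 ⟨_, _, _, fun he => hs.1.ne (hinj _ ma _ ms he),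
    fun he => (by linarith : a ≠ a + h) (hinj _ ma _ mb he),
    fun he => hs.2.ne (hinj _ ms _ mb he), rfl⟩] at hcard
  omega

/-- The zeros before a given zero are the ones at multiples of half a period. -/
theorem exists_eq_sub_of_zero {q : ℝ → ℝ} {h : ℝ} (hh : 0 < h) (hanti : ∀ t, q (t + h) = -q t)
    (hgap : ∀ a s, q a = 0 → s ∈ Ioo a (a + h) → q s ≠ 0) {t s : ℝ} (ht : q t = 0) (hs : q s = 0)
    (hst : s < t) : ∃ l : ℕ, s = t - (l + 1 : ℕ) * h := by
  have hz : ∀ m : ℕ, q (s + m * h) = 0 := by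
    intro m
    induction m with
    | zero => simpa using hs
    | succ m ih =>
      push_cast
      rw [add_mul, one_mul, ← add_assoc, hanti, ih, neg_zero]
  -- Zeros propagate from `s` in steps of `h`, and `s + m h` is the last one not after `t`; as the
  -- gap behind it is free of zeros, it equals `t`.
  obtain ⟨m, hm⟩ : ∃ m : ℕ, m = ⌊(t - s) / h⌋₊ := ⟨_, rfl⟩
  have h1 : (m : ℝ) * h ≤ t - s := by
    rw [hm, ← le_div_iff₀ hh]
    exact Nat.floor_le (div_nonneg (by linarith) hh.le)
  have h2 : t - s < (m + 1) * h := by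
    rw [hm, ← div_lt_iff₀ hh]
    exact Nat.lt_floor_add_one _
  have h3 : t = s + m * h := by
    by_contra hne
    refine hgap (s + m * h) t (hz m) ⟨lt_of_le_of_ne (by linarith) (Ne.symm hne), ?_⟩ ht
    linarith
  rcases m with _ | m
  · simp only [Nat.cast_zero, zero_mul, add_zero] at h3
    linarith
  · exact ⟨m, by rw [h3]; ring⟩

end Zeros

/-! ### Exponential integrals of linear blocks over an interval -/

/-- The integral of `f(t) e^{-st}` over an interval. -/
def expCoeff (a b : ℝ) (s : ℂ) (f : ℝ → ℝ) : ℂ := ∫ t in a..b, (f t : ℂ) * Complex.exp (-(s * t))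

section ExpCoeff

variable {a b : ℝ} {s : ℂ}

theorem intervalIntegrable_expCoeff (hab : a ≤ b) {f : ℝ → ℝ} (hf : ContinuousOn f (Icc a b)) :
    IntervalIntegrable (fun t => (f t : ℂ) * Complex.exp (-(s * t))) MeasureTheory.volume a b := by
  refine ContinuousOn.intervalIntegrable ?_
  rw [uIcc_of_le hab]
  exact (Complex.continuous_ofReal.comp_continuousOn hf).mul (by fun_prop)

theorem expCoeff_congr (hab : a ≤ b) {f g : ℝ → ℝ} (h : ∀ t ∈ Ioc a b, f t = g t) :
    expCoeff a b s f = expCoeff a b s g := by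
  refine intervalIntegral.integral_congr_ae (MeasureTheory.ae_of_all _ fun t ht => ?_)
  rw [uIoc_of_le hab] at ht
  rw [h t ht]

theorem expCoeff_add (hab : a ≤ b) {f g : ℝ → ℝ} (hf : ContinuousOn f (Icc a b))
    (hg : ContinuousOn g (Icc a b)) :
    expCoeff a b s (fun t => f t + g t) = expCoeff a b s f + expCoeff a b s g := by
  rw [expCoeff, expCoeff, expCoeff, ← intervalIntegral.integral_add
    (intervalIntegrable_expCoeff hab hf) (intervalIntegrable_expCoeff hab hg)]
  congr! 2
  push_cast
  ring

theorem expCoeff_const_mul (d : ℝ) (f : ℝ → ℝ) :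
    expCoeff a b s (fun t => d * f t) = d * expCoeff a b s f := by
  rw [expCoeff, expCoeff, ← intervalIntegral.integral_const_mul]
  congr! 2
  push_cast
  ring

theorem expCoeff_sub (hab : a ≤ b) {f g : ℝ → ℝ} (hf : ContinuousOn f (Icc a b))
    (hg : ContinuousOn g (Icc a b)) :
    expCoeff a b s (fun t => f t - g t) = expCoeff a b s f - expCoeff a b s g := by
  rw [expCoeff, expCoeff, expCoeff, ← intervalIntegral.integral_sub
    (intervalIntegrable_expCoeff hab hf) (intervalIntegrable_expCoeff hab hg)]
  congr! 2
  push_cast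
  ring

theorem expCoeff_dotProduct (hab : a ≤ b) {ι : Type*} [Fintype ι] (c : ι → ℝ) {x : ℝ → ι → ℝ}
    (hx : ContinuousOn x (Icc a b)) :
    expCoeff a b s (fun t => c ⬝ᵥ x t) =
      (fun i => (c i : ℂ)) ⬝ᵥ fun i => expCoeff a b s fun t => x t i := by
  simp only [dotProduct]
  rw [show (∑ i, (c i : ℂ) * expCoeff a b s fun t => x t i) =
    ∑ i, expCoeff a b s fun t => c i * x t i by simp only [expCoeff_const_mul]]
  simp only [expCoeff]
  have hc : ∀ i, ContinuousOn (fun t => c i * x t i) (Icc a b) := fun i => by fun_prop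
  rw [← intervalIntegral.integral_finsetSum fun i _ => intervalIntegrable_expCoeff hab (hc i)]
  congr! 2
  push_cast
  rw [Finset.sum_mul]

theorem expCoeff_out (hab : a ≤ b) {ι : Type*} [Fintype ι] (S : Block ι) {x : ℝ → ι → ℝ}
    {w : ℝ → ℝ} (hx : ContinuousOn x (Icc a b)) (hw : ContinuousOn w (Icc a b)) :
    expCoeff a b s (fun t => S.out (x t) (w t)) =
      ((fun i => (S.C i : ℂ)) ⬝ᵥ fun i => expCoeff a b s fun t => x t i) +
        S.D * expCoeff a b s w := by
  simp only [Block.out]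
  rw [expCoeff_add hab (by simp only [dotProduct]; fun_prop)
    (by fun_prop : ContinuousOn (fun t => S.D * w t) (Icc a b)), expCoeff_dotProduct hab _ hx,
    expCoeff_const_mul]

theorem expCoeff_deriv (hab : a ≤ b) {f f' : ℝ → ℝ} (hf : ContinuousOn f (Icc a b))
    (hf' : ContinuousOn f' (Icc a b)) (hd : ∀ t ∈ Ioo a b, HasDerivAt f (f' t) t) :
    expCoeff a b s f' = s * expCoeff a b s f +
      (f b * Complex.exp (-(s * b)) - f a * Complex.exp (-(s * a))) := by
  have h1 := intervalIntegral.integral_eq_sub_of_hasDerivAt_of_le hab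
    (f := fun t : ℝ => (f t : ℂ) * Complex.exp (-(s * t)))
    (f' := fun t : ℝ => (f' t : ℂ) * Complex.exp (-(s * t)) -
      s * ((f t : ℂ) * Complex.exp (-(s * t))))
    ((Complex.continuous_ofReal.comp_continuousOn hf).mul (by fun_prop))
    (fun t ht => by
      have e1 : HasDerivAt (fun t : ℝ => -(s * (t : ℂ))) (-s) t := by
        simpa using ((Complex.ofRealCLM.hasDerivAt (x := t)).const_mul s).fun_neg
      convert! (hd t ht).ofReal_comp.mul e1.cexp using 1
      ring)
    ((intervalIntegrable_expCoeff hab hf').sub ((intervalIntegrable_expCoeff hab hf).const_mul s))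
  rw [intervalIntegral.integral_sub (intervalIntegrable_expCoeff hab hf')
    ((intervalIntegrable_expCoeff hab hf).const_mul s), intervalIntegral.integral_const_mul] at h1
  simp only [expCoeff]
  linear_combination h1

/-- The state equation of a linear block in terms of the integrals over an interval. -/
theorem mulVec_expCoeff (hab : a ≤ b) {ι : Type*} [Fintype ι] [DecidableEq ι] (S : Block ι)
    {x : ℝ → ι → ℝ} {w : ℝ → ℝ} (hx : ContinuousOn x (Icc a b)) (hw : ContinuousOn w (Icc a b))
    (hd : ∀ t ∈ Ioo a b, HasDerivAt x (S.vel (x t) (w t)) t) :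
    (s • (1 : Matrix ι ι ℂ) - toC S.A).mulVec (fun i => expCoeff a b s fun t => x t i) =
      expCoeff a b s w • (fun i => (S.B i : ℂ)) + (Complex.exp (-(s * a)) • (fun i => (x a i : ℂ)) -
        Complex.exp (-(s * b)) • fun i => (x b i : ℂ)) := by
  funext i
  have hxi : ContinuousOn (fun t => x t i) (Icc a b) := (continuous_apply i).comp_continuousOn hx
  have hv : ∀ t, S.vel (x t) (w t) i = S.A i ⬝ᵥ x t + S.B i * w t := fun t => by
    simp [Block.vel, Matrix.mulVec, mul_comm]
  have hc1 : ContinuousOn (fun t => S.A i ⬝ᵥ x t) (Icc a b) := by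
    simp only [dotProduct]; fun_prop
  have hc2 : ContinuousOn (fun t => S.B i * w t) (Icc a b) := continuousOn_const.mul hw
  have h1 := expCoeff_deriv (s := s) hab (f' := fun t => S.A i ⬝ᵥ x t + S.B i * w t) hxi
    (hc1.add hc2) fun t ht => by
      rw [← hv]
      exact hasDerivAt_pi.1 (hd t ht) i
  rw [expCoeff_add hab hc1 hc2, expCoeff_dotProduct hab _ hx,
    expCoeff_const_mul] at h1
  have h2 : (toC S.A).mulVec (fun j => expCoeff a b s fun t => x t j) i =
      (fun j => (S.A i j : ℂ)) ⬝ᵥ fun j => expCoeff a b s fun t => x t j := rfl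
  rw [Matrix.sub_mulVec, Matrix.smul_mulVec, Matrix.one_mulVec, Pi.sub_apply, h2]
  simp only [Pi.sub_apply, Pi.smul_apply, smul_eq_mul, Pi.add_apply]
  linear_combination -h1

theorem expCoeff_state (hab : a ≤ b) {ι : Type*} [Fintype ι] [DecidableEq ι] {S : Block ι}
    (hs : S.RegularAt s) {x : ℝ → ι → ℝ} {w : ℝ → ℝ} (hx : ContinuousOn x (Icc a b))
    (hw : ContinuousOn w (Icc a b)) (hd : ∀ t ∈ Ioo a b, HasDerivAt x (S.vel (x t) (w t)) t) :
    (fun i => expCoeff a b s fun t => x t i) =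
      (S.res s).mulVec (expCoeff a b s w • (fun i => (S.B i : ℂ)) +
        (Complex.exp (-(s * a)) • (fun i => (x a i : ℂ)) -
        Complex.exp (-(s * b)) • fun i => (x b i : ℂ))) := by
  rw [← mulVec_expCoeff hab S hx hw hd, Matrix.mulVec_mulVec, Block.res,
    Matrix.nonsing_inv_mul _ hs, Matrix.one_mulVec]

/-- The transfer function relates input and output over a half-period. -/
theorem expCoeff_out_eq_tf (hab : a ≤ b) {ι : Type*} [Fintype ι] [DecidableEq ι] {S : Block ι}
    (hs : S.RegularAt s) {x : ℝ → ι → ℝ} {w : ℝ → ℝ} (hx : ContinuousOn x (Icc a b))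
    (hw : ContinuousOn w (Icc a b)) (hd : ∀ t ∈ Ioo a b, HasDerivAt x (S.vel (x t) (w t)) t)
    (hexp : Complex.exp (-(s * b)) = -Complex.exp (-(s * a))) (hanti : x b = -x a) :
    expCoeff a b s (fun t => S.out (x t) (w t)) = S.tf s * expCoeff a b s w := by
  -- Both the state and `e^{-st}` change sign across the interval, so their product takes equal
  -- values at the two ends.
  have h0 : (Complex.exp (-(s * a)) • (fun i => (x a i : ℂ)) -
        Complex.exp (-(s * b)) • fun i => (x b i : ℂ)) = 0 := by
    funext i
    simp [hexp, hanti]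
  rw [expCoeff_out hab S hx hw, expCoeff_state hab hs hx hw hd, h0, add_zero, Matrix.mulVec_smul,
    dotProduct_smul, Block.tf, smul_eq_mul]
  ring

end ExpCoeff

/-! ### The algebraic loop and continuous half-periods -/

section AlgebraicLoop

variable {k r c p : Type*} [Fintype k] [Fintype r] [Fintype c] [Fintype p]

/-- The input of the reset element as a function of the states and the reference. -/
def Loop.loopInput (L : Loop k r c p) (xK : k → ℝ) (xR : r → ℝ) (xC : c → ℝ) (xP : p → ℝ)
    (ref : ℝ) : ℝ :=
  (L.K.C ⬝ᵥ xK + L.K.D * (ref - (L.P.C ⬝ᵥ xP + L.P.D * (L.C.C ⬝ᵥ xC + L.C.D * (L.R.C ⬝ᵥ xR))))) /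
    (1 + L.K.D * L.R.D * L.C.D * L.P.D)

/-- The loop equation is affine in `q`, and the coefficient of `q` is the nonzero number of
well-posedness. -/
theorem Loop.WellPosed.eq_loopInput_iff {L : Loop k r c p} (hwp : L.WellPosed) {xK : k → ℝ}
    {xR : r → ℝ} {xC : c → ℝ} {xP : p → ℝ} {ref q : ℝ} :
    q = L.loopInput xK xR xC xP ref ↔
      q = L.K.out xK (ref - L.P.out xP (L.C.out xC (L.R.out xR q))) := by
  rw [Loop.loopInput, eq_div_iff hwp]
  simp only [Block.out]
  constructor <;> intro h <;> linear_combination h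

/-- The signals of a loop as functions of the states and the reference. -/
def Loop.signals (L : Loop k r c p) (ref : ℝ → ℝ) (xK : ℝ → k → ℝ) (xR : ℝ → r → ℝ)
    (xC : ℝ → c → ℝ) (xP : ℝ → p → ℝ) : Signals k r c p where
  xK := xK
  xR := xR
  xC := xC
  xP := xP
  e := fun t => ref t - L.P.out (xP t) (L.C.out (xC t) (L.R.out (xR t)
    (L.loopInput (xK t) (xR t) (xC t) (xP t) (ref t))))
  q := fun t => L.loopInput (xK t) (xR t) (xC t) (xP t) (ref t)
  v := fun t => L.R.out (xR t) (L.loopInput (xK t) (xR t) (xC t) (xP t) (ref t))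
  u := fun t => L.C.out (xC t) (L.R.out (xR t) (L.loopInput (xK t) (xR t) (xC t) (xP t) (ref t)))
  y := fun t => L.P.out (xP t) (L.C.out (xC t) (L.R.out (xR t)
    (L.loopInput (xK t) (xR t) (xC t) (xP t) (ref t))))

/-- A half-period of a response with half-wave symmetry between the resets at `a` and `b`; here the
state of the reset element at `a` is the one just after the reset. -/
structure Loop.IsHalfPeriod (L : Loop k r c p) (ref : ℝ → ℝ) (a b : ℝ) (x₀ : r → ℝ)
    (z : Signals k r c p) : Prop where
  e_eq : ∀ t, z.e t = ref t - z.y t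
  q_eq : ∀ t, z.q t = L.K.out (z.xK t) (z.e t)
  v_eq : ∀ t, z.v t = L.R.out (z.xR t) (z.q t)
  u_eq : ∀ t, z.u t = L.C.out (z.xC t) (z.v t)
  y_eq : ∀ t, z.y t = L.P.out (z.xP t) (z.u t)
  flow_K : ∀ t ∈ Ioo a b, HasDerivAt z.xK (L.K.vel (z.xK t) (z.e t)) t
  flow_R : ∀ t ∈ Ioo a b, HasDerivAt z.xR (L.R.vel (z.xR t) (z.q t)) t
  flow_C : ∀ t ∈ Ioo a b, HasDerivAt z.xC (L.C.vel (z.xC t) (z.v t)) t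
  flow_P : ∀ t ∈ Ioo a b, HasDerivAt z.xP (L.P.vel (z.xP t) (z.u t)) t
  cont_K : ContinuousOn z.xK (Icc a b)
  cont_R : ContinuousOn z.xR (Icc a b)
  cont_C : ContinuousOn z.xC (Icc a b)
  cont_P : ContinuousOn z.xP (Icc a b)
  cont_e : ContinuousOn z.e (Icc a b)
  cont_q : ContinuousOn z.q (Icc a b)
  cont_v : ContinuousOn z.v (Icc a b)
  cont_u : ContinuousOn z.u (Icc a b)
  anti_K : z.xK b = -z.xK a
  anti_C : z.xC b = -z.xC a
  anti_P : z.xP b = -z.xP a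
  start_R : z.xR a = L.Aρ.mulVec x₀
  end_R : z.xR b = -x₀

theorem continuousOn_out {ι : Type*} [Fintype ι] (S : Block ι) {x : ℝ → ι → ℝ} {w : ℝ → ℝ}
    {T : Set ℝ} (hx : ContinuousOn x T) (hw : ContinuousOn w T) :
    ContinuousOn (fun t => S.out (x t) (w t)) T := by
  simp only [Block.out, dotProduct]
  fun_prop

/-- States are left-continuous, so signals may jump just after `a`. Replacing the reset state at `a`
by its value after the reset, and solving the algebraic loop again, changes the signals only at `a`
and makes them continuous on the closed interval. -/
theorem Loop.IsResponse.isHalfPeriod {L : Loop k r c p} (hwp : L.WellPosed) {ref : ℝ → ℝ}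
    (href : Continuous ref) {z : Signals k r c p} (hz : L.IsResponse ref z) {a b : ℝ}
    (hab : a < b) (ha : z.q a = 0) (hq : ∀ t ∈ Ioo a b, z.q t ≠ 0)
    (hK : z.xK b = -z.xK a) (hR : z.xR b = -z.xR a) (hC : z.xC b = -z.xC a)
    (hP : z.xP b = -z.xP a) :
    ∃ z' : Signals k r c p, L.IsHalfPeriod ref a b (z.xR a) z' ∧
      ∀ t ∈ Ioc a b, z'.xR t = z.xR t ∧ z'.e t = z.e t ∧ z'.q t = z.q t ∧ z'.u t = z.u t ∧
        z'.y t = z.y t := by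
  classical
  set xR' : ℝ → r → ℝ := Function.update z.xR a (L.Aρ.mulVec (z.xR a)) with hxR'
  set z' := L.signals ref z.xK xR' z.xC z.xP with hz'
  have hRt : ∀ t, t ≠ a → xR' t = z.xR t := fun t ht => Function.update_of_ne ht _ _
  have hqt : ∀ t, t ≠ a → z'.q t = z.q t := by
    intro t ht
    symm
    change _ = L.loopInput (z.xK t) (xR' t) (z.xC t) (z.xP t) (ref t)
    rw [hwp.eq_loopInput_iff, hRt t ht, ← hz.v_eq, ← hz.u_eq, ← hz.y_eq, ← hz.e_eq, ← hz.q_eq]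
  have hvt : ∀ t, t ≠ a → z'.v t = z.v t := fun t ht => by
    change L.R.out (xR' t) (z'.q t) = _
    rw [hqt t ht, hRt t ht, hz.v_eq]
  have hut : ∀ t, t ≠ a → z'.u t = z.u t := fun t ht => by
    change L.C.out (z.xC t) (z'.v t) = _
    rw [hvt t ht, hz.u_eq]
  have hyt : ∀ t, t ≠ a → z'.y t = z.y t := fun t ht => by
    change L.P.out (z.xP t) (z'.u t) = _
    rw [hut t ht, hz.y_eq]
  have het : ∀ t, t ≠ a → z'.e t = z.e t := fun t ht => by
    change ref t - z'.y t = _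
    rw [hyt t ht, hz.e_eq]
  have cK : ContinuousOn z'.xK (Icc a b) := hz.cont_K.continuousOn
  have cC : ContinuousOn z'.xC (Icc a b) := hz.cont_C.continuousOn
  have cP : ContinuousOn z'.xP (Icc a b) := hz.cont_P.continuousOn
  have cR : ContinuousOn z'.xR (Icc a b) := by
    intro t ht
    change ContinuousWithinAt xR' _ _
    rcases eq_or_lt_of_le ht.1 with rfl | hat
    · rw [hxR', continuousWithinAt_update_same]
      refine (hz.reset _ ha).mono_left (nhdsWithin_mono _ ?_)
      rintro s ⟨hs, hne⟩
      exact lt_of_le_of_ne hs.1 (Ne.symm hne)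
    · rw [hxR', continuousWithinAt_update_of_ne hat.ne']
      rcases eq_or_lt_of_le ht.2 with rfl | htb
      · exact (hz.left_R t).continuousWithinAt.mono fun s hs => hs.2
      · exact (hz.flow_R t (hq t ⟨hat, htb⟩)).continuousAt.continuousWithinAt
  have cq : ContinuousOn z'.q (Icc a b) := by
    change ContinuousOn (fun t => L.loopInput (z'.xK t) (z'.xR t) (z'.xC t) (z'.xP t) (ref t)) _
    simp only [Loop.loopInput, dotProduct]
    fun_prop
  have cv : ContinuousOn z'.v (Icc a b) := continuousOn_out L.R cR cq
  have cu : ContinuousOn z'.u (Icc a b) := continuousOn_out L.C cC cv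
  have cy : ContinuousOn z'.y (Icc a b) := continuousOn_out L.P cP cu
  have ce : ContinuousOn z'.e (Icc a b) := href.continuousOn.sub cy
  have ne : ∀ t ∈ Ioo a b, t ≠ a := fun t ht => ht.1.ne'
  refine ⟨z', ?_, fun t ht => ?_⟩
  · exact
    { e_eq := fun t => rfl
      q_eq := fun t => (hwp.eq_loopInput_iff (q := z'.q t)).1 rfl
      v_eq := fun t => rfl
      u_eq := fun t => rfl
      y_eq := fun t => rfl
      flow_K := fun t ht => by rw [het t (ne t ht)]; exact hz.flow_K t (hq t ht)
      flow_R := fun t ht => by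
        have h1 := hz.flow_R t (hq t ht)
        rw [hqt t (ne t ht), show z'.xR t = z.xR t from hRt t (ne t ht)]
        refine h1.congr_of_eventuallyEq ?_
        filter_upwards [isOpen_ne.mem_nhds (ne t ht)] with s hs using hRt s hs
      flow_C := fun t ht => by rw [hvt t (ne t ht)]; exact hz.flow_C t (hq t ht)
      flow_P := fun t ht => by rw [hut t (ne t ht)]; exact hz.flow_P t (hq t ht)
      cont_K := cK
      cont_R := cR
      cont_C := cC
      cont_P := cP
      cont_e := ce
      cont_q := cq
      cont_v := cv
      cont_u := cu
      anti_K := hK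
      anti_C := hC
      anti_P := hP
      start_R := Function.update_self _ _ _
      end_R := by rw [show z'.xR b = z.xR b from hRt b hab.ne', hR] }
  · have := ht.1.ne'
    exact ⟨hRt t this, het t this, hqt t this, hut t this, hyt t this⟩

end AlgebraicLoop

/-! ### The loop equations for odd harmonics -/

section HalfPeriod

variable {k r c p : Type*} [Fintype k] [Fintype r] [Fintype c] [Fintype p]
  [DecidableEq k] [DecidableEq r] [DecidableEq c] [DecidableEq p]

/-- Each block acts by its transfer function, except for the boundary term of the reset element:
`x_R` runs from `Aρ x₀` to `-x₀`, which leaves `e^{-sa} (Aρ - 1) x₀`, as if a single impulse drove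
the linear loop. -/
theorem Loop.IsHalfPeriod.expCoeff_eq {L : Loop k r c p} {ref : ℝ → ℝ} {a b : ℝ} (hab : a ≤ b)
    {x₀ : r → ℝ} {z : Signals k r c p} (hz : L.IsHalfPeriod ref a b x₀ z) (href : Continuous ref)
    {s : ℂ} (hs : L.RegularAt s) (hexp : Complex.exp (-(s * b)) = -Complex.exp (-(s * a)))
    {J : r → ℂ} (hJ : J = Complex.exp (-(s * a)) • fun i => (x₀ i : ℂ)) :
    expCoeff a b s z.e = L.SL s * (expCoeff a b s ref - L.G s * (L.Rδ s).mulVec J ()) ∧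
    expCoeff a b s z.q = L.K.tf s * L.SL s * expCoeff a b s ref - (L.Qδ s).mulVec J () ∧
    (fun i => expCoeff a b s fun t => z.xR t i) =
      (L.K.tf s * L.SL s * expCoeff a b s ref) • (L.R.res s).mulVec (fun i => (L.R.B i : ℂ)) +
        (L.H s).mulVec J ∧
    expCoeff a b s z.y = L.P.tf s * expCoeff a b s z.u := by
  obtain ⟨sK, sR, sC, sP, hne⟩ := hs
  have cy : ContinuousOn z.y (Icc a b) := by
    rw [show z.y = fun t => L.P.out (z.xP t) (z.u t) from funext hz.y_eq]
    exact continuousOn_out _ hz.cont_P hz.cont_u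
  have hQ : expCoeff a b s z.q = L.K.tf s * expCoeff a b s z.e := by
    rw [show z.q = fun t => L.K.out (z.xK t) (z.e t) from funext hz.q_eq]
    exact expCoeff_out_eq_tf hab sK hz.cont_K hz.cont_e hz.flow_K hexp hz.anti_K
  have hU : expCoeff a b s z.u = L.C.tf s * expCoeff a b s z.v := by
    rw [show z.u = fun t => L.C.out (z.xC t) (z.v t) from funext hz.u_eq]
    exact expCoeff_out_eq_tf hab sC hz.cont_C hz.cont_v hz.flow_C hexp hz.anti_C
  have hY : expCoeff a b s z.y = L.P.tf s * expCoeff a b s z.u := by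
    rw [show z.y = fun t => L.P.out (z.xP t) (z.u t) from funext hz.y_eq]
    exact expCoeff_out_eq_tf hab sP hz.cont_P hz.cont_u hz.flow_P hexp hz.anti_P
  have hE : expCoeff a b s z.e = expCoeff a b s ref - expCoeff a b s z.y := by
    rw [show z.e = fun t => ref t - z.y t from funext hz.e_eq]
    exact expCoeff_sub hab href.continuousOn cy
  have hX : (fun i => expCoeff a b s fun t => z.xR t i) =
      expCoeff a b s z.q • (L.R.res s).mulVec (fun i => (L.R.B i : ℂ)) + (L.RXδ s).mulVec J := by
    rw [expCoeff_state hab sR hz.cont_R hz.cont_q hz.flow_R, Matrix.mulVec_add, Matrix.mulVec_smul,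
      Loop.RXδ, ← Matrix.mulVec_mulVec]
    congr 2
    funext i
    have h1 : ((L.Aρ.mulVec x₀ i : ℝ) : ℂ) = (toC L.Aρ).mulVec (fun i => (x₀ i : ℂ)) i := by
      simp [Matrix.mulVec, dotProduct]
    have h2 : toC (L.Aρ - 1) = toC L.Aρ - 1 := by
      ext i j
      by_cases h : i = j <;> simp [h]
    rw [hJ, h2, Matrix.sub_mulVec, Matrix.one_mulVec, Matrix.mulVec_smul]
    simp only [hexp, hz.start_R, hz.end_R, Pi.sub_apply, Pi.smul_apply, smul_eq_mul, h1,
      Pi.neg_apply, Complex.ofReal_neg]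
    ring
  have hV : expCoeff a b s z.v = L.R.tf s * expCoeff a b s z.q + (L.Rδ s).mulVec J () := by
    rw [show z.v = fun t => L.R.out (z.xR t) (z.q t) from funext hz.v_eq,
      expCoeff_out hab L.R hz.cont_R hz.cont_q, hX, dotProduct_add, dotProduct_smul, Block.tf,
      Loop.Rδ, ← Matrix.mulVec_mulVec, smul_eq_mul]
    have : (Matrix.replicateRow Unit fun i => (L.R.C i : ℂ)).mulVec ((L.RXδ s).mulVec J) () =
      (fun i => (L.R.C i : ℂ)) ⬝ᵥ (L.RXδ s).mulVec J := rfl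
    rw [this]
    ring
  have hE' : expCoeff a b s z.e =
      L.SL s * (expCoeff a b s ref - L.G s * (L.Rδ s).mulVec J ()) := by
    rw [Loop.SL, inv_mul_eq_div, eq_div_iff hne, Loop.G]
    linear_combination hE - hY - L.P.tf s * hU - L.P.tf s * L.C.tf s * hV -
      L.P.tf s * L.C.tf s * L.R.tf s * hQ
  have hQ' : expCoeff a b s z.q =
      L.K.tf s * L.SL s * expCoeff a b s ref - (L.Qδ s).mulVec J () := by
    rw [hQ, hE', Loop.Qδ, Matrix.smul_mulVec, Pi.smul_apply, smul_eq_mul]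
    ring
  refine ⟨hE', hQ', ?_, hY⟩
  rw [hX, hQ', Loop.H, Matrix.sub_mulVec, ← Matrix.mulVec_mulVec, ← Matrix.mulVec_mulVec, sub_smul]
  have : (Matrix.replicateCol Unit fun i => (L.R.B i : ℂ)).mulVec ((L.Qδ s).mulVec J) =
      (L.Qδ s).mulVec J () • fun i => (L.R.B i : ℂ) := by
    funext i
    simp [Matrix.mulVec, dotProduct, mul_comm]
  rw [this, Matrix.mulVec_smul]
  abel

end HalfPeriod

/-! ### Sinusoids and harmonics on a half-period -/

section Sinusoid

theorem continuous_sinusoid (ω : ℝ) (R : ℂ) : Continuous (sinusoid ω R) := by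
  unfold sinusoid
  fun_prop

theorem sinusoid_add_half {ω : ℝ} (hω : 0 < ω) (R : ℂ) (t : ℝ) :
    sinusoid ω R (t + Real.pi / ω) = -sinusoid ω R t := by
  rw [sinusoid, sinusoid, show ω * (t + Real.pi / ω) + R.arg = ω * t + R.arg + Real.pi by
    field_simp; ring, Real.sin_add_pi]
  ring

theorem sinusoid_eq_im (ω : ℝ) (R : ℂ) (t : ℝ) :
    sinusoid ω R t = (R * Complex.exp (Complex.I * ω * t)).im := by
  conv_rhs => rw [← Complex.norm_mul_exp_arg_mul_I R]
  rw [mul_assoc, ← Complex.exp_add, Complex.im_ofReal_mul,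
    show (R.arg : ℂ) * Complex.I + Complex.I * ω * t = ((ω * t + R.arg : ℝ) : ℂ) * Complex.I by
      push_cast; ring, Complex.exp_ofReal_mul_I_im, sinusoid]

theorem sinusoid_eq_exp (ω : ℝ) (R : ℂ) (t : ℝ) :
    (sinusoid ω R t : ℂ) = (R * Complex.exp (Complex.I * ω * t) -
      (starRingEnd ℂ) R * Complex.exp (-(Complex.I * ω * t))) / (2 * Complex.I) := by
  have h1 := Complex.sub_conj (R * Complex.exp (Complex.I * ω * t))
  rw [← sinusoid_eq_im, map_mul, ← Complex.exp_conj] at h1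
  have h2 : (starRingEnd ℂ) (Complex.I * ω * t) = -(Complex.I * ω * t) := by simp
  rw [h2] at h1
  rw [h1]
  have := Complex.I_ne_zero
  push_cast
  field_simp

theorem integral_exp_even {ω : ℝ} (hω : 0 < ω) (a : ℝ) {m : ℕ} (hm : Even m) :
    ∫ t in a..(a + Real.pi / ω), Complex.exp (-(Complex.I * m * ω * t)) =
      if m = 0 then (Real.pi / ω : ℂ) else 0 := by
  have hωc : (ω : ℂ) ≠ 0 := by exact_mod_cast hω.ne'
  split_ifs with h0
  · simp [h0]
  · have hmc : (m : ℂ) ≠ 0 := by exact_mod_cast h0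
    have hc : -(Complex.I * m * ω) ≠ 0 :=
      neg_ne_zero.2 (mul_ne_zero (mul_ne_zero Complex.I_ne_zero hmc) hωc)
    have h1 := integral_exp_mul_complex (a := a) (b := a + Real.pi / ω) hc
    simp only [neg_mul] at h1
    rw [h1]
    have h2 : Complex.exp (-(Complex.I * m * ω * (a + Real.pi / ω : ℝ))) =
        Complex.exp (-(Complex.I * m * ω * a)) := by
      rw [Complex.exp_eq_exp_iff_exists_int]
      obtain ⟨l, hl⟩ := hm
      refine ⟨-l, ?_⟩
      rw [hl]
      push_cast
      field_simp
      ring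
    rw [h2, sub_self, zero_div]

/-- For odd `n` the two exponentials have the even frequencies `n - 1` and `n + 1`, which integrate
to zero over a half-period unless `n - 1 = 0`; the conjugate phasor never survives. -/
theorem expCoeff_sinusoid {ω : ℝ} (hω : 0 < ω) (a : ℝ) (R : ℂ) {n : ℕ} (hn : Odd n) :
    expCoeff a (a + Real.pi / ω) (Complex.I * n * ω) (sinusoid ω R) =
      R * if n = 1 then Real.pi / (2 * Complex.I * ω) else 0 := by
  obtain ⟨l, rfl⟩ := hn
  have h1 : ∀ t : ℝ, (sinusoid ω R t : ℂ) *
      Complex.exp (-(Complex.I * (2 * l + 1 : ℕ) * ω * t)) =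
      R / (2 * Complex.I) * Complex.exp (-(Complex.I * (2 * l : ℕ) * ω * t)) -
      (starRingEnd ℂ) R / (2 * Complex.I) *
        Complex.exp (-(Complex.I * (2 * l + 2 : ℕ) * ω * t)) := by
    intro t
    have e1 : Complex.exp (-(Complex.I * (2 * l : ℕ) * ω * t)) = Complex.exp (Complex.I * ω * t) *
        Complex.exp (-(Complex.I * (2 * l + 1 : ℕ) * ω * t)) := by
      rw [← Complex.exp_add]
      push_cast
      ring_nf
    have e2 : Complex.exp (-(Complex.I * (2 * l + 2 : ℕ) * ω * t)) =
        Complex.exp (-(Complex.I * ω * t)) *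
          Complex.exp (-(Complex.I * (2 * l + 1 : ℕ) * ω * t)) := by
      rw [← Complex.exp_add]
      push_cast
      ring_nf
    rw [sinusoid_eq_exp, e1, e2]
    ring
  rw [expCoeff]
  simp only [h1]
  rw [intervalIntegral.integral_sub, intervalIntegral.integral_const_mul,
    intervalIntegral.integral_const_mul, integral_exp_even hω a (even_two_mul l),
    integral_exp_even hω a ⟨l + 1, by ring⟩, if_neg (by omega : ¬ 2 * l + 2 = 0), mul_zero,
    sub_zero]
  · have hωc : (ω : ℂ) ≠ 0 := by exact_mod_cast hω.ne'
    rcases l with _ | l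
    · have := Complex.I_ne_zero
      simp only [mul_zero, if_true, zero_add]
      field_simp
    · rw [if_neg (by omega), if_neg (by omega)]
      simp
  · exact Continuous.intervalIntegrable (by fun_prop) _ _
  · exact Continuous.intervalIntegrable (by fun_prop) _ _

theorem exp_half_period {ω : ℝ} (hω : 0 < ω) (a : ℝ) {n : ℕ} (hn : Odd n) :
    Complex.exp (-(Complex.I * n * ω * (a + Real.pi / ω : ℝ))) =
      -Complex.exp (-(Complex.I * n * ω * a)) := by
  have hωc : (ω : ℂ) ≠ 0 := by exact_mod_cast hω.ne'
  have h1 : -(Complex.I * n * ω * (a + Real.pi / ω : ℝ)) =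
      -(Complex.I * n * ω * a) + -(n * (Real.pi * Complex.I)) := by
    push_cast
    field_simp
    ring
  rw [h1, Complex.exp_add, Complex.exp_neg (n * (Real.pi * Complex.I)), Complex.exp_nat_mul,
    Complex.exp_pi_mul_I, hn.neg_one_pow]
  norm_num

/-- The harmonics of a half-wave symmetric function in terms of half a period. -/
theorem harmonic_eq_expCoeff {ω : ℝ} (hω : 0 < ω) (a : ℝ) {f : ℝ → ℝ}
    (hf : ∀ t, f (t + Real.pi / ω) = -f t) (n : ℕ)
    (hint : IntervalIntegrable (fun t => (f t : ℂ) * Complex.exp (-(Complex.I * n * ω * t)))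
      MeasureTheory.volume a (a + Real.pi / ω)) :
    harmonic ω n f = if Odd n then (Complex.I * ω / Real.pi) *
      (2 * expCoeff a (a + Real.pi / ω) (Complex.I * n * ω) f) else 0 := by
  set h := Real.pi / ω with hh
  have hωc : (ω : ℂ) ≠ 0 := by exact_mod_cast hω.ne'
  set g : ℝ → ℂ := fun t => (f t : ℂ) * Complex.exp (-(Complex.I * n * ω * t)) with hg
  -- The second half-period doubles the first for odd `n` and cancels it for even `n`.
  have hgh : ∀ t, g (t + h) = (-1) ^ (n + 1) * g t := by
    intro t
    have h1 : -(Complex.I * n * ω * (t + h : ℝ)) =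
        -(Complex.I * n * ω * t) + -(n * (Real.pi * Complex.I)) := by
      rw [hh]
      push_cast
      field_simp
      ring
    rw [hg]
    simp only [hf, h1, Complex.exp_add, Complex.exp_neg (n * (Real.pi * Complex.I)),
      Complex.exp_nat_mul, Complex.exp_pi_mul_I]
    rcases Nat.even_or_odd n with hn | hn
    · simp [hn.neg_one_pow, hn.add_one.neg_one_pow]
    · simp [hn.neg_one_pow, hn.add_one.neg_one_pow]
  have hper : Function.Periodic g (2 * Real.pi / ω) := by
    intro t
    rw [show t + 2 * Real.pi / ω = t + h + h by rw [hh]; ring, hgh, hgh, ← mul_assoc, ← pow_add,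
      Even.neg_one_pow ⟨_, rfl⟩, one_mul]
  have h2 := hper.intervalIntegral_add_eq 0 a
  have hshift : ∫ t in (a + h)..(a + h + h), g t = (-1) ^ (n + 1) * ∫ t in a..(a + h), g t := by
    rw [← intervalIntegral.integral_comp_add_right g h, ← intervalIntegral.integral_const_mul]
    simp only [hgh]
  have hint2 : IntervalIntegrable g MeasureTheory.volume (a + h) (a + h + h) := by
    have h3 := (hint.const_mul ((-1) ^ (n + 1))).comp_sub_right h
    refine h3.congr ?_
    refine fun t _ => ?_
    have := hgh (t - h)
    rw [sub_add_cancel] at this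
    exact this.symm
  rw [zero_add] at h2
  rw [harmonic, h2, show a + 2 * Real.pi / ω = a + h + h by rw [hh]; ring,
    ← intervalIntegral.integral_add_adjacent_intervals hint hint2, hshift]
  split_ifs with hn
  · rw [hn.add_one.neg_one_pow, expCoeff]
    ring
  · rw [(Nat.not_odd_iff_even.1 hn).add_one.neg_one_pow]
    ring

end Sinusoid

/-! ### Response to an alternating impulse train -/

section Impulse

variable {σ m n : Type*} [Fintype σ] [DecidableEq σ] [Fintype n]

theorem Hurwitz.isUnit_det {A : Matrix σ σ ℝ} (hA : Hurwitz A) {s : ℂ} (hs : s.re = 0) :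
    s ∉ spectrum ℂ (toC A) ∧ IsUnit (s • (1 : Matrix σ σ ℂ) - toC A).det := by
  have h1 : s ∉ spectrum ℂ (toC A) := fun h => (hA s h).ne hs
  refine ⟨h1, ?_⟩
  rw [← Matrix.isUnit_iff_isUnit_det]
  rw [spectrum.notMem_iff, Algebra.algebraMap_eq_smul_one] at h1
  exact h1

/-- The response of a stable realization to an alternating impulse train, over half a period. -/
theorem Realization.exists_impulse_response (S : Realization σ m n) (hS : Hurwitz S.A) {ω : ℝ}
    (hω : 0 < ω) (a : ℝ) (x₀ : n → ℝ) :
    ∃ f : ℝ → m → ℝ, Continuous f ∧ f (a + Real.pi / ω) = -(S.altSum ω).mulVec x₀ ∧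
      ∀ l : ℕ, Odd l → ∀ i, expCoeff a (a + Real.pi / ω) (Complex.I * l * ω) (fun t => f t i) =
        (S.tf (Complex.I * l * ω)).mulVec
          (Complex.exp (-(Complex.I * l * ω * a)) • fun j => (x₀ j : ℂ)) i := by
  have hpos : 0 < Real.pi / ω := by positivity
  have hN := hS.one_add_mul_tsum hpos
  have halt := S.altSum_eq hS hω
  set h := Real.pi / ω with hh
  generalize hNdef : ∑' m : ℕ, (-NormedSpace.exp (h • S.A)) ^ m = N at hN halt
  -- The initial state `(1 + e^{hA})⁻¹ B x₀` is the one for which the free flow to `a + h`, followed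
  -- by the impulse `-B x₀`, ends in its own negative.
  set w : σ → ℝ := N.mulVec (S.B.mulVec x₀) with hw
  set g : ℝ → σ → ℝ := fun t => (NormedSpace.exp ((t - a) • S.A)).mulVec w with hg
  have hgd : ∀ t, HasDerivAt g (S.A.mulVec (g t)) t := fun t =>
    hasDerivAt_exp_sub_smul_mulVec S.A a w t
  have hgc : Continuous g := continuous_iff_continuousAt.2 fun t => (hgd t).continuousAt
  have hga : g a = w := by simp [hg]
  have hgb : g (a + h) = (NormedSpace.exp (h • S.A)).mulVec w := by simp [hg]
  have hgab : g a + g (a + h) = S.B.mulVec x₀ := by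
    have := congrArg (fun X => X.mulVec (S.B.mulVec x₀)) hN
    simp only [add_mul, one_mul, Matrix.add_mulVec, Matrix.one_mulVec] at this
    rw [hga, hgb, hw, Matrix.mulVec_mulVec _ _ N]
    exact this
  refine ⟨fun t => S.C.mulVec (g t), ?_, ?_, ?_⟩
  · exact Continuous.matrix_mulVec continuous_const hgc
  · change S.C.mulVec (g (a + h)) = _
    rw [hgb, hw, halt, Matrix.neg_mulVec, neg_neg, Matrix.mulVec_mulVec, Matrix.mulVec_mulVec,
      Matrix.mulVec_mulVec]
    simp only [Matrix.mul_assoc]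
  · intro l hl i
    set s : ℂ := Complex.I * l * ω with hs
    have hsre : s.re = 0 := by simp [hs]
    have hu := (hS.isUnit_det hsre).2
    have h1 := expCoeff_state (a := a) (b := a + h) (s := s) (by linarith)
      (S := (⟨S.A, 0, 0, 0⟩ : Block σ)) hu (x := g) (w := fun _ => 0) hgc.continuousOn
      continuousOn_const (fun t _ => by simpa [Block.vel] using hgd t)
    have h2 : (Complex.exp (-(s * a)) • (fun i => (g a i : ℂ)) -
        Complex.exp (-(s * (a + h : ℝ))) • fun i => (g (a + h) i : ℂ)) =
        (toC S.B).mulVec (Complex.exp (-(s * a)) • fun j => (x₀ j : ℂ)) := by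
      rw [exp_half_period hω a hl, ← hs, neg_smul, sub_neg_eq_add, ← smul_add, Matrix.mulVec_smul]
      congr 1
      funext i
      have := congrFun hgab i
      rw [Pi.add_apply] at this ⊢
      rw [← Complex.ofReal_add, this]
      simp [Matrix.mulVec, dotProduct]
    have h4 : (expCoeff a (a + h) s fun _ => 0) •
        (fun i => (((⟨S.A, 0, 0, 0⟩ : Block σ).B i : ℝ) : ℂ)) = 0 := by
      funext i
      simp
    rw [h2, h4, zero_add] at h1
    have h3 : expCoeff a (a + h) s (fun t => S.C.mulVec (g t) i) =
        (toC S.C).mulVec (fun i => expCoeff a (a + h) s fun t => g t i) i :=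
      expCoeff_dotProduct (by linarith) (S.C i) hgc.continuousOn
    rw [h3, h1, Realization.tf, ← Matrix.mulVec_mulVec, ← Matrix.mulVec_mulVec]
    rfl

end Impulse

/-! ### Equations for the reset instant and the reset state -/

section ResetEquations

variable {k r c p σ τ : Type*} [Fintype k] [Fintype r] [Fintype c] [Fintype p]
  [DecidableEq k] [DecidableEq r] [DecidableEq c] [DecidableEq p]
  [Fintype σ] [DecidableEq σ] [Fintype τ] [DecidableEq τ]

/-- The conditions on the reset state that result from the steady-state response in closed form. -/
theorem Loop.IsHalfPeriod.reset_equations {L : Loop k r c p} {ω : ℝ} (hω : 0 < ω) {RI : ℂ} {a : ℝ}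
    {x₀ : r → ℝ} {z : Signals k r c p}
    (hz : L.IsHalfPeriod (sinusoid ω RI) a (a + Real.pi / ω) x₀ z)
    (hreg : ∀ n : ℕ, 1 ≤ n → L.RegularAt (Complex.I * n * ω))
    {SQ : Realization σ Unit r} (hSQ : L.Realizes SQ L.Qδ) (hSQ_stable : Hurwitz SQ.A)
    {SH : Realization τ r r} (hSH : L.Realizes SH L.H) (hSH_stable : Hurwitz SH.A)
    (hq : z.q (a + Real.pi / ω) = 0) :
    sinusoid ω (L.KSR ω RI) a = (SQ.altSum ω).mulVec x₀ () ∧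
    ∀ i, x₀ i = sinusoid ω (L.KSR ω RI *
      (L.R.res (Complex.I * ω)).mulVec (fun i => (L.R.B i : ℂ)) i) a +
        (SH.altSum ω).mulVec x₀ i := by
  have hpos : 0 < Real.pi / ω := by positivity
  have hab : a ≤ a + Real.pi / ω := by linarith
  have hb : a + Real.pi / ω ∈ Icc a (a + Real.pi / ω) := ⟨hab, le_rfl⟩
  have hcoef := fun (n : ℕ) (hn : Odd n) => hz.expCoeff_eq hab (continuous_sinusoid ω RI)
    (hreg n hn.pos) (exp_half_period hω a hn) rfl
  have hcs : ∀ R, ContinuousOn (fun t => sinusoid ω R t) (Icc a (a + Real.pi / ω)) :=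
    fun R => (continuous_sinusoid ω R).continuousOn
  have hre : ∀ n : ℕ, (Complex.I * n * ω).re = 0 := fun n => by simp
  constructor
  · obtain ⟨f, hfc, hfb, hf⟩ := SQ.exists_impulse_response hSQ_stable hω a x₀
    have hc2 : Continuous fun t => f t () := (continuous_apply ()).comp hfc
    have hcd : ContinuousOn (fun t => z.q t - sinusoid ω (L.KSR ω RI) t)
        (Icc a (a + Real.pi / ω)) := hz.cont_q.sub (hcs _)
    -- The equality is evaluated at the right end, where `q` vanishes and the impulse response is
    -- minus the alternating sum; the half-period shift returns the sinusoid to `a`.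
    have h0 := eq_zero_of_odd_coefficients_eq_zero (a := a) hω
      (f := fun t => z.q t - sinusoid ω (L.KSR ω RI) t + f t ())
      (hcd.add hc2.continuousOn)
      (fun n hn => by
        change expCoeff _ _ _ _ = 0
        rw [expCoeff_add hab hcd
          hc2.continuousOn, expCoeff_sub hab hz.cont_q (hcs _),
          (hcoef n hn).2.1, hf n hn (), expCoeff_sinusoid hω a RI hn,
          expCoeff_sinusoid hω a _ hn, hSQ _ (hreg n hn.pos) (hSQ_stable.isUnit_det (hre n)).1]
        split_ifs with h1
        · subst h1
          rw [Loop.KSR, Nat.cast_one, mul_one]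
          ring
        · ring) _ hb
    rw [hq, hfb, sinusoid_add_half hω, Pi.neg_apply] at h0
    linarith
  · intro i
    obtain ⟨f, hfc, hfb, hf⟩ := SH.exists_impulse_response hSH_stable hω a x₀
    have hc2 : Continuous fun t => f t i := (continuous_apply i).comp hfc
    have hc1 : ContinuousOn (fun t => z.xR t i) (Icc a (a + Real.pi / ω)) :=
      (continuous_apply i).comp_continuousOn hz.cont_R
    set ρ := L.KSR ω RI * (L.R.res (Complex.I * ω)).mulVec (fun i => (L.R.B i : ℂ)) i with hρ
    have hcd : ContinuousOn (fun t => z.xR t i - sinusoid ω ρ t) (Icc a (a + Real.pi / ω)) :=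
      hc1.sub (hcs _)
    -- Same comparison for the state, which equals `-x₀` at the right end.
    have h0 := eq_zero_of_odd_coefficients_eq_zero (a := a) hω
      (f := fun t => z.xR t i - sinusoid ω ρ t - f t i)
      (hcd.sub hc2.continuousOn)
      (fun n hn => by
        change expCoeff _ _ _ _ = 0
        have h2 := congrFun (hcoef n hn).2.2.1 i
        rw [expCoeff_sub hab hcd
          hc2.continuousOn, expCoeff_sub hab hc1 (hcs _),
          h2, hf n hn i, Pi.add_apply, Pi.smul_apply, smul_eq_mul, expCoeff_sinusoid hω a RI hn,
          expCoeff_sinusoid hω a _ hn, hSH _ (hreg n hn.pos) (hSH_stable.isUnit_det (hre n)).1]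
        split_ifs with h1
        · subst h1
          rw [hρ, Loop.KSR, Nat.cast_one, mul_one]
          ring
        · ring) _ hb
    rw [hz.end_R, hfb, sinusoid_add_half hω, Pi.neg_apply, Pi.neg_apply] at h0
    linarith

end ResetEquations

/-! ### Real form of the resolvent at `jω` -/

section Realness

variable {k r c p : Type*} [Fintype r] [DecidableEq r]

theorem toC_mul {l m n : Type*} [Fintype m] (A : Matrix l m ℝ) (B : Matrix m n ℝ) :
    toC (A * B) = toC A * toC B := by
  ext i j
  simp [Matrix.mul_apply]

theorem toC_mulVec {m n : Type*} [Fintype n] (A : Matrix m n ℝ) (x : n → ℝ) :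
    (toC A).mulVec (fun i => (x i : ℂ)) = fun i => ((A.mulVec x i : ℝ) : ℂ) := by
  funext i
  simp [Matrix.mulVec, dotProduct]

theorem toC_one {n : Type*} [DecidableEq n] : toC (1 : Matrix n n ℝ) = 1 := by
  ext i j
  by_cases h : i = j <;> simp [h, Matrix.one_apply]

theorem Loop.toC_Lam (L : Loop k r c p) (ω : ℝ) :
    toC (L.Lam ω) = ((Complex.I * ω) • (1 : Matrix r r ℂ) - toC L.R.A) *
      ((-(Complex.I * ω)) • (1 : Matrix r r ℂ) - toC L.R.A) := by
  have h1 : toC (L.Lam ω) = ((ω : ℂ) ^ 2) • (1 : Matrix r r ℂ) + toC L.R.A * toC L.R.A := by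
    rw [Loop.Lam, sq L.R.A, ← toC_mul, ← toC_one]
    ext i j
    by_cases hij : i = j <;> simp [hij]
  have h2 : Complex.I * ω * -(Complex.I * ω) = (ω : ℂ) ^ 2 := by
    linear_combination -(ω : ℂ) ^ 2 * Complex.I_sq
  rw [h1, sub_mul, mul_sub, mul_sub, Matrix.smul_mul, Matrix.smul_mul, Matrix.one_mul,
    Matrix.mul_smul, Matrix.mul_one, smul_smul, h2, neg_smul, Matrix.one_mul]
  abel

theorem Loop.RstarDF_smul (L : Loop k r c p) (ω : ℝ) (n : ℕ) (d : ℝ) (B : r → ℝ) :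
    L.RstarDF ω n (d • B) = d * L.RstarDF ω n B := by
  rw [Loop.RstarDF, Loop.RstarDF]
  split_ifs
  · have : (fun i => (((d • B) i : ℝ) : ℂ)) = (d : ℂ) • fun i => (B i : ℂ) := by
      funext i
      simp
    rw [this, Matrix.mulVec_smul, dotProduct_smul, smul_eq_mul]
  · rw [mul_zero]

/-- The factors `jω - A_R` and `-jω - A_R` of `Λ` are complex conjugates because `A_R` is real, so
regularity at `jω` covers both. -/
theorem Loop.isUnit_det_Lam {L : Loop k r c p} {ω : ℝ} (h : L.R.RegularAt (Complex.I * ω)) :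
    IsUnit (L.Lam ω).det := by
  have h1 : ((-(Complex.I * ω)) • (1 : Matrix r r ℂ) - toC L.R.A) =
      (starRingEnd ℂ).mapMatrix ((Complex.I * ω) • (1 : Matrix r r ℂ) - toC L.R.A) := by
    ext i j
    by_cases hij : i = j <;> simp [hij]
  have h2 : ((L.Lam ω).det : ℂ) = (toC (L.Lam ω)).det :=
    RingHom.map_det Complex.ofRealHom (L.Lam ω)
  rw [L.toC_Lam, Matrix.det_mul, h1, ← RingHom.map_det] at h2
  rw [isUnit_iff_ne_zero]
  intro h0
  rw [h0, Complex.ofReal_zero] at h2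
  have h3 : ((Complex.I * ω) • (1 : Matrix r r ℂ) - toC L.R.A).det ≠ 0 := isUnit_iff_ne_zero.1 h
  exact mul_ne_zero h3 ((map_ne_zero _).2 h3) h2.symm

/-- The response of the state of the reset element to a sinusoid, without resets. -/
theorem Loop.res_mulVec_B {L : Loop k r c p} {ω : ℝ} (h : L.R.RegularAt (Complex.I * ω)) (i : r) :
    (L.R.res (Complex.I * ω)).mulVec (fun i => (L.R.B i : ℂ)) i =
      -(((L.Lam ω)⁻¹ * L.R.A).mulVec L.R.B i : ℝ) -
        Complex.I * (ω * ((L.Lam ω)⁻¹).mulVec L.R.B i : ℝ) := by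
  have hL := Loop.isUnit_det_Lam h
  have hcomm : L.R.A * (L.Lam ω)⁻¹ = (L.Lam ω)⁻¹ * L.R.A := by
    have h1 : L.R.A * L.Lam ω = L.Lam ω * L.R.A := by
      rw [Loop.Lam, mul_add, add_mul, Matrix.mul_smul, Matrix.smul_mul, mul_one, one_mul,
        ← pow_succ', ← pow_succ]
    calc L.R.A * (L.Lam ω)⁻¹ = (L.Lam ω)⁻¹ * (L.Lam ω * L.R.A) * (L.Lam ω)⁻¹ := by
          rw [← mul_assoc, Matrix.nonsing_inv_mul _ hL, one_mul]
      _ = (L.Lam ω)⁻¹ * L.R.A := by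
          rw [← h1, mul_assoc, mul_assoc, Matrix.mul_nonsing_inv _ hL, mul_one]
  have hres : L.R.res (Complex.I * ω) =
      ((-(Complex.I * ω)) • (1 : Matrix r r ℂ) - toC L.R.A) * toC (L.Lam ω)⁻¹ := by
    refine Matrix.inv_eq_right_inv ?_
    rw [← mul_assoc, ← L.toC_Lam, ← toC_mul, Matrix.mul_nonsing_inv _ hL, toC_one]
  rw [hres, ← Matrix.mulVec_mulVec, toC_mulVec, Matrix.sub_mulVec, toC_mulVec, Matrix.smul_mulVec,
    Matrix.one_mulVec, ← hcomm, ← Matrix.mulVec_mulVec]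
  simp only [Pi.sub_apply, Pi.smul_apply, smul_eq_mul]
  push_cast
  ring

end Realness

/-! ### The virtual input matrix and the reset part -/

section ResetElement

variable {k r c p σ τ : Type*} [Fintype k] [Fintype r] [Fintype c] [Fintype p]
  [DecidableEq k] [DecidableEq r] [DecidableEq c] [DecidableEq p]
  [Fintype σ] [DecidableEq σ] [Fintype τ] [DecidableEq τ]

/-- This has the shape of `Loop.res_mulVec_B`: it splits the base response of the reset state into a
sine part and a cosine part. -/
theorem sinusoid_mul (ω : ℝ) (R : ℂ) (α β t : ℝ) :
    sinusoid ω (R * (-α - Complex.I * β)) t =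
      -(sinusoid ω R t * α) - ‖R‖ * Real.cos (ω * t + R.arg) * β := by
  have h1 : R * Complex.exp (Complex.I * ω * t) =
      (‖R‖ * Real.cos (ω * t + R.arg) : ℝ) + (sinusoid ω R t : ℝ) * Complex.I := by
    conv_lhs => rw [← Complex.norm_mul_exp_arg_mul_I R]
    rw [mul_assoc, ← Complex.exp_add,
      show (R.arg : ℂ) * Complex.I + Complex.I * ω * t = ((ω * t + R.arg : ℝ) : ℂ) * Complex.I by
      push_cast; ring, Complex.exp_mul_I, sinusoid]
    push_cast
    ring
  rw [sinusoid_eq_im, mul_right_comm, h1]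
  generalize Real.cos (ω * t + R.arg) = C
  generalize sinusoid ω R t = S
  simp
  ring

/-- With `M = e^{πA_R/ω}`, the identity `Aρ (1 + M Aρ) = (1 + Aρ M) Aρ` cancels `Δ_D`. What remains
is `(1 + M) Aρ - (1 + M Aρ) = Aρ - 1`. -/
theorem Loop.ThetaD_mulVec_Bstar {L : Loop k r c p} {ω : ℝ} (hω : ω ≠ 0) {RI : ℂ}
    (hκ : ‖L.KSR ω RI‖ ≠ 0)
    (hΛ : IsUnit (L.Lam ω).det) (hΔ : IsUnit (L.Del ω).det) (hΔD : IsUnit (L.DelD ω).det)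
    (x : r → ℝ) :
    (L.ThetaD ω).mulVec (L.Bstar ω RI x) =
      (-(2 * ω / (Real.pi * ‖L.KSR ω RI‖))) • (L.Aρ - 1).mulVec x := by
  have h1 : (L.DelD ω)⁻¹ * L.Aρ * (1 + L.expHalf ω * L.Aρ) = L.Aρ := by
    have h2 : L.Aρ * (1 + L.expHalf ω * L.Aρ) = L.DelD ω * L.Aρ := by
      rw [Loop.DelD, mul_add, add_mul, mul_one, one_mul, mul_assoc]
    rw [mul_assoc, h2, ← mul_assoc, Matrix.nonsing_inv_mul _ hΔD, one_mul]
  have h3 : L.Del ω * (L.GamD ω - (L.Lam ω)⁻¹) *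
      (L.Lam ω * (L.Del ω)⁻¹ * (1 + L.expHalf ω * L.Aρ)) = L.Aρ - 1 := by
    calc _ = L.Del ω * ((L.DelD ω)⁻¹ * L.Aρ * (L.Del ω * ((L.Lam ω)⁻¹ * L.Lam ω) * (L.Del ω)⁻¹) -
          (L.Lam ω)⁻¹ * L.Lam ω * (L.Del ω)⁻¹) * (1 + L.expHalf ω * L.Aρ) := by
          rw [Loop.GamD]; noncomm_ring
      _ = L.Del ω * ((L.DelD ω)⁻¹ * L.Aρ * (1 + L.expHalf ω * L.Aρ)) -
          L.Del ω * (L.Del ω)⁻¹ * (1 + L.expHalf ω * L.Aρ) := by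
          rw [Matrix.nonsing_inv_mul _ hΛ, mul_one, Matrix.mul_nonsing_inv _ hΔ]; noncomm_ring
          rw [← mul_assoc (L.Del ω) (L.Del ω)⁻¹, Matrix.mul_nonsing_inv _ hΔ]; noncomm_ring
      _ = L.Aρ - 1 := by
          rw [h1, Matrix.mul_nonsing_inv _ hΔ, Loop.Del]; noncomm_ring
  rw [Loop.ThetaD, Loop.Bstar, Matrix.mulVec_smul, Matrix.smul_mulVec, Matrix.mulVec_mulVec, h3,
    smul_smul]
  congr 1
  field_simp

/-- The reset-induced part of the describing function in terms of the reset state. -/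
theorem Loop.RstarDF_Bstar {L : Loop k r c p} {ω : ℝ} (hω : ω ≠ 0) {RI : ℂ}
    (hκ : ‖L.KSR ω RI‖ ≠ 0)
    (hΛ : IsUnit (L.Lam ω).det) (hΔ : IsUnit (L.Del ω).det) (hΔD : IsUnit (L.DelD ω).det)
    (x : r → ℝ) {n : ℕ} (hn : Odd n) :
    L.RstarDF ω n (L.Bstar ω RI x) * ‖L.KSR ω RI‖ = -(2 * Complex.I * ω / Real.pi) *
      (L.Rδ (Complex.I * n * ω)).mulVec (fun i => (x i : ℂ)) () := by
  have h1 : (L.R.res (Complex.I * n * ω) * (Complex.I • toC (L.ThetaD ω))).mulVec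
      (fun i => (L.Bstar ω RI x i : ℂ)) =
      (-(2 * Complex.I * ω / (Real.pi * ‖L.KSR ω RI‖))) •
        (L.RXδ (Complex.I * n * ω)).mulVec (fun i => (x i : ℂ)) := by
    rw [Loop.RXδ, ← Matrix.mulVec_mulVec, ← Matrix.mulVec_mulVec, Matrix.smul_mulVec, toC_mulVec,
      toC_mulVec, Loop.ThetaD_mulVec_Bstar hω hκ hΛ hΔ hΔD, Matrix.mulVec_smul]
    have h4 : ∀ (d : ℝ) (v : r → ℝ), (fun i => (((d • v) i : ℝ) : ℂ)) =
        (d : ℂ) • fun i => (v i : ℂ) := fun d v => by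
      funext i
      simp
    rw [h4, Matrix.mulVec_smul, smul_smul]
    congr 1
    push_cast
    ring
  have h2 : (‖L.KSR ω RI‖ : ℂ) ≠ 0 := by exact_mod_cast hκ
  have hpi : (Real.pi : ℂ) ≠ 0 := by exact_mod_cast Real.pi_ne_zero
  have h3 : (L.Rδ (Complex.I * n * ω)).mulVec (fun i => (x i : ℂ)) () =
      (fun i => (L.R.C i : ℂ)) ⬝ᵥ (L.RXδ (Complex.I * n * ω)).mulVec (fun i => (x i : ℂ)) := by
    rw [Loop.Rδ, ← Matrix.mulVec_mulVec]
    rfl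
  rw [Loop.RstarDF, if_pos hn, h1, dotProduct_smul, smul_eq_mul, h3]
  field_simp

/-- `B⋆` is linear in the state, so apart from the factor `d` only the unimodular phase depends on
the scaling. -/
theorem Loop.norm_resetPart_smul_sub (L : Loop k r c p) (SQ : Realization σ Unit r) (ω : ℝ) (RI : ℂ)
    (d : ℝ) (x : r → ℝ) (n : ℕ) :
    ‖L.resetPart SQ ω RI (d • x) n - L.resetPart SQ ω RI x n‖ = ‖L.resetPart SQ ω RI x n‖ *
      ‖(d : ℂ) * Complex.exp (Complex.I * n * L.Φ SQ ω RI (d • x)) -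
        Complex.exp (Complex.I * n * L.Φ SQ ω RI x)‖ := by
  have he : ∀ x : ℝ, ‖Complex.exp (Complex.I * n * x)‖ = 1 := fun x => by
    rw [show Complex.I * n * x = ((n * x : ℝ) : ℂ) * Complex.I by push_cast; ring]
    exact Complex.norm_exp_ofReal_mul_I _
  have hP : ∀ y : r → ℝ, L.Psi SQ ω RI y n = (‖L.KSR ω RI‖ : ℂ) *
      Complex.exp (Complex.I * n * (L.KSR ω RI).arg) *
        Complex.exp (Complex.I * n * L.Φ SQ ω RI y) := by
    intro y
    rw [Loop.Psi, mul_assoc (‖L.KSR ω RI‖ : ℂ), ← Complex.exp_add]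
    push_cast
    ring_nf
  have hB : L.Bstar ω RI (d • x) = d • L.Bstar ω RI x := by
    rw [Loop.Bstar, Loop.Bstar, Matrix.mulVec_smul, smul_comm]
  have h1 : L.resetPart SQ ω RI (d • x) n - L.resetPart SQ ω RI x n =
      L.SL (Complex.I * n * ω) * (L.G (Complex.I * n * ω) * L.RstarDF ω n (L.Bstar ω RI x) *
        ((‖L.KSR ω RI‖ : ℂ) * Complex.exp (Complex.I * n * (L.KSR ω RI).arg))) *
      ((d : ℂ) * Complex.exp (Complex.I * n * L.Φ SQ ω RI (d • x)) -
        Complex.exp (Complex.I * n * L.Φ SQ ω RI x)) := by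
    rw [Loop.resetPart, Loop.resetPart, hP, hP, hB, Loop.RstarDF_smul]
    ring
  rw [h1, norm_mul, Loop.resetPart, hP]
  congr 1
  simp only [norm_mul, he, mul_one]

end ResetElement

/-! ### Harmonics and reset state in the steady state -/

section SteadyState

variable {k r c p σ τ : Type*} [Fintype k] [Fintype r] [Fintype c] [Fintype p]
  [DecidableEq k] [DecidableEq r] [DecidableEq c] [DecidableEq p]
  [Fintype σ] [DecidableEq σ] [Fintype τ] [DecidableEq τ]

/-- The signals may jump just after a reset; the continuous version `g` may differ from `f` at the
left end, which the integral does not see. -/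
theorem harmonic_eq_of_eqOn {ω : ℝ} (hω : 0 < ω) (a : ℝ) {f g : ℝ → ℝ}
    (hf : ∀ t, f (t + Real.pi / ω) = -f t) (hg : ContinuousOn g (Icc a (a + Real.pi / ω)))
    (hfg : ∀ t ∈ Ioc a (a + Real.pi / ω), g t = f t) (n : ℕ) :
    harmonic ω n f = if Odd n then (Complex.I * ω / Real.pi) *
      (2 * expCoeff a (a + Real.pi / ω) (Complex.I * n * ω) g) else 0 := by
  have hab : a ≤ a + Real.pi / ω := by have : 0 < Real.pi / ω := by positivity
                                       linarith
  rw [harmonic_eq_expCoeff hω a hf n, expCoeff_congr hab hfg]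
  refine (intervalIntegrable_expCoeff (s := Complex.I * n * ω) hab hg).congr fun t ht => ?_
  rw [uIoc_of_le hab] at ht
  simp only [hfg t ht]

theorem add_half_eq_neg {E : Type*} [AddCommGroup E] [Module ℝ E] {x : ℝ → E} {h : ℝ}
    (hx : (fun t => (-1 : ℝ) • x (t + h)) = x) (t : ℝ) : x (t + h) = -x t := by
  have h1 : (-1 : ℝ) • x (t + h) = x t := congrFun hx t
  rw [← h1, neg_one_smul, neg_neg]

theorem refPhasor_one (RI : ℂ) : refPhasor RI 1 = RI := by
  rw [refPhasor, Nat.cast_one, mul_one, mul_comm Complex.I, Complex.norm_mul_exp_arg_mul_I]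

theorem norm_refPhasor (RI : ℂ) (n : ℕ) : ‖refPhasor RI n‖ = ‖RI‖ := by
  rw [refPhasor, norm_mul, Complex.norm_real, norm_norm,
    show Complex.I * n * RI.arg = ((n * RI.arg : ℝ) : ℂ) * Complex.I by push_cast; ring,
    Complex.norm_exp_ofReal_mul_I, mul_one]

theorem Loop.IsHalfPeriod.harmonic_eq {L : Loop k r c p} {ω : ℝ} (hω : 0 < ω) {RI : ℂ} {a : ℝ}
    {x₀ : r → ℝ} {z z' : Signals k r c p}
    (hz' : L.IsHalfPeriod (sinusoid ω RI) a (a + Real.pi / ω) x₀ z')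
    (hsym : z.transform (-1) (Real.pi / ω) = z)
    (heq : ∀ t ∈ Ioc a (a + Real.pi / ω), z'.xR t = z.xR t ∧ z'.e t = z.e t ∧ z'.q t = z.q t ∧
      z'.u t = z.u t ∧ z'.y t = z.y t) {n : ℕ} (hn : 1 ≤ n)
    (hreg : L.RegularAt (Complex.I * n * ω)) :
    harmonic ω n z.e = (if n = 1 then L.SL (Complex.I * ω) * RI else 0) -
      (if Odd n then L.SL (Complex.I * n * ω) * (L.G (Complex.I * n * ω) *
        (2 * Complex.I * ω / Real.pi * Complex.exp (-(Complex.I * n * ω * a)) *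
        (L.Rδ (Complex.I * n * ω)).mulVec (fun i => (x₀ i : ℂ)) ())) else 0) ∧
    harmonic ω n z.y = idHarmonic n * refPhasor RI n - harmonic ω n z.e ∧
    harmonic ω n z.y = L.P.tf (Complex.I * n * ω) * harmonic ω n z.u := by
  have hpos : 0 < Real.pi / ω := by positivity
  have hab : a ≤ a + Real.pi / ω := by linarith
  have hωc : (ω : ℂ) ≠ 0 := by exact_mod_cast hω.ne'
  have hpi : (Real.pi : ℂ) ≠ 0 := by exact_mod_cast Real.pi_ne_zero
  have hI := Complex.I_ne_zero
  have cy : ContinuousOn z'.y (Icc a (a + Real.pi / ω)) := by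
    rw [show z'.y = fun t => L.P.out (z'.xP t) (z'.u t) from funext hz'.y_eq]
    exact continuousOn_out _ hz'.cont_P hz'.cont_u
  rw [harmonic_eq_of_eqOn hω a (add_half_eq_neg (congrArg Signals.e hsym)) hz'.cont_e
      (fun t ht => (heq t ht).2.1),
    harmonic_eq_of_eqOn hω a (add_half_eq_neg (congrArg Signals.y hsym)) cy
      (fun t ht => (heq t ht).2.2.2.2),
    harmonic_eq_of_eqOn hω a (add_half_eq_neg (congrArg Signals.u hsym)) hz'.cont_u
      (fun t ht => (heq t ht).2.2.2.1)]
  by_cases ho : Odd n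
  · obtain ⟨hE, -, -, hY⟩ := hz'.expCoeff_eq hab (continuous_sinusoid ω RI) hreg
      (exp_half_period hω a ho) rfl
    have hE2 : expCoeff a (a + Real.pi / ω) (Complex.I * n * ω) z'.e =
        expCoeff a (a + Real.pi / ω) (Complex.I * n * ω) (sinusoid ω RI) -
          expCoeff a (a + Real.pi / ω) (Complex.I * n * ω) z'.y := by
      rw [← expCoeff_sub hab (continuous_sinusoid ω RI).continuousOn cy]
      exact expCoeff_congr hab fun t _ => hz'.e_eq t
    rw [expCoeff_sinusoid hω a RI ho] at hE hE2
    rw [Matrix.mulVec_smul, Pi.smul_apply, smul_eq_mul] at hE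
    simp only [if_pos ho]
    refine ⟨?_, ?_, ?_⟩
    · rw [hE]
      split_ifs with h1
      · subst h1
        rw [Nat.cast_one, mul_one]
        field_simp
      · ring
    · have : expCoeff a (a + Real.pi / ω) (Complex.I * n * ω) z'.y =
        (RI * if n = 1 then (Real.pi / (2 * Complex.I * ω) : ℂ) else 0) -
          expCoeff a (a + Real.pi / ω) (Complex.I * n * ω) z'.e := by rw [hE2]; ring
      rw [this, idHarmonic]
      split_ifs with h1
      · subst h1
        rw [refPhasor_one]
        field_simp
      · ring
    · rw [hY]
      ring
  · have h1 : n ≠ 1 := fun h => ho (h ▸ odd_one)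
    simp [ho, h1, idHarmonic]

/-- At a descending reset the phase of the base linear response is `π - Φ`. -/
theorem cos_arcsin_of_cos_neg {θ s : ℝ} (hs : Real.sin θ = s) (hc : Real.cos θ < 0) :
    Real.sin (Real.arcsin s) = s ∧ Real.cos θ = -Real.cos (Real.arcsin s) := by
  have h1 : -1 ≤ s := hs ▸ Real.neg_one_le_sin θ
  have h2 : s ≤ 1 := hs ▸ Real.sin_le_one θ
  refine ⟨Real.sin_arcsin h1 h2, ?_⟩
  rw [Real.cos_arcsin, ← hs, ← Real.abs_cos_eq_sqrt_one_sub_sin_sq, abs_of_neg hc, neg_neg]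

/-- The hypotheses say `e^{-jθ} = -e^{jφ}`; an odd power keeps the sign. -/
theorem exp_of_cos_neg {θ φ : ℝ} (hs : Real.sin θ = Real.sin φ) (hc : Real.cos θ = -Real.cos φ)
    {n : ℕ} (hn : Odd n) :
    Complex.exp (-(Complex.I * n * θ)) = -Complex.exp (Complex.I * n * φ) := by
  have h1 : Complex.exp (-(θ * Complex.I)) = -Complex.exp (φ * Complex.I) := by
    rw [← neg_mul, ← Complex.ofReal_neg, Complex.exp_mul_I, Complex.exp_mul_I, ← Complex.ofReal_cos,
      ← Complex.ofReal_sin, ← Complex.ofReal_cos, ← Complex.ofReal_sin, Real.cos_neg, Real.sin_neg,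
      hc, hs]
    push_cast
    ring
  have h2 := congrArg (· ^ n) h1
  simp only [hn.neg_pow, ← Complex.exp_nat_mul] at h2
  convert! h2 using 2
  · ring_nf
  · ring_nf

/-- The sum of the impulse responses of all prior resets. -/
theorem tsum_impulse_eq_altSum {n : Type*} [Fintype n]
    {SQ : Realization σ Unit n} (hS : Hurwitz SQ.A) {ω : ℝ} (hω : 0 < ω) {q : ℝ → ℝ} {x : ℝ → n → ℝ}
    (hq : ∀ t, q (t + Real.pi / ω) = -q t)
    (hx : ∀ t, x (t + Real.pi / ω) = -x t)
    (hgap : ∀ a s, q a = 0 → s ∈ Ioo a (a + Real.pi / ω) → q s ≠ 0) {t : ℝ} (ht : q t = 0) :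
    ∑' s : {s : ℝ // s < t ∧ q s = 0}, (SQ.impulse (t - s)).mulVec (x s) () =
      (SQ.altSum ω).mulVec (x t) () := by
  have hpos : 0 < Real.pi / ω := by positivity
  have hxs : ∀ l : ℕ, x (t - l * (Real.pi / ω)) = (-1 : ℝ) ^ l • x t := by
    intro l
    induction l with
    | zero => simp
    | succ l ih =>
      have := hx (t - (l + 1 : ℕ) * (Real.pi / ω))
      rw [show t - (l + 1 : ℕ) * (Real.pi / ω) + Real.pi / ω = t - l * (Real.pi / ω) by
        push_cast; ring, ih] at this
      rw [pow_succ, mul_neg_one, neg_smul, this, neg_neg]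
  have hqs : ∀ l : ℕ, q (t - l * (Real.pi / ω)) = 0 := by
    intro l
    induction l with
    | zero => simpa using ht
    | succ l ih =>
      have := hq (t - (l + 1 : ℕ) * (Real.pi / ω))
      rw [show t - (l + 1 : ℕ) * (Real.pi / ω) + Real.pi / ω = t - l * (Real.pi / ω) by
        push_cast; ring, ih] at this
      linarith
  -- Enumeration of the earlier resets; `l + 1` excludes the reset at `t` itself.
  let e : ℕ → {s : ℝ // s < t ∧ q s = 0} := fun l => ⟨t - (l + 1 : ℕ) * (Real.pi / ω),
    sub_lt_self _ (mul_pos (by exact_mod_cast l.succ_pos) hpos), hqs (l + 1)⟩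
  have he : Function.Bijective e := by
    constructor
    · intro l l' h
      have h1 := congrArg Subtype.val h
      have h2 : ((l + 1 : ℕ) : ℝ) = (l' + 1 : ℕ) :=
        mul_right_cancel₀ hpos.ne' (sub_right_injective h1)
      exact Nat.succ_injective (by exact_mod_cast h2)
    · rintro ⟨s, hst, hs⟩
      obtain ⟨l, hl⟩ := exists_eq_sub_of_zero hpos hq hgap ht hs hst
      exact ⟨l, Subtype.ext hl.symm⟩
  rw [← (Equiv.ofBijective e he).tsum_eq]
  have hsum := SQ.hasSum_alternating_impulse hS hω (x t) ()
  rw [← hsum.tsum_eq]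
  refine tsum_congr fun l => ?_
  change (SQ.impulse (t - (t - (l + 1 : ℕ) * (Real.pi / ω)))).mulVec
    (x (t - (l + 1 : ℕ) * (Real.pi / ω))) () = _
  rw [hxs, sub_sub_cancel]

/-- The reset state in terms of the analytical reset state. -/
theorem Loop.eq_cos_smul_resetState {L : Loop k r c p} {ω : ℝ} {RI : ℂ}
    (hR : L.R.RegularAt (Complex.I * ω)) {SQ : Realization σ Unit r} {SH : Realization τ r r}
    (hM : IsUnit (L.resetMatrix SQ SH ω).det) {a d : ℝ} {x₀ : r → ℝ}
    (h1 : sinusoid ω (L.KSR ω RI) a = (SQ.altSum ω).mulVec x₀ ())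
    (h2 : ∀ i, x₀ i = sinusoid ω (L.KSR ω RI *
      (L.R.res (Complex.I * ω)).mulVec (fun i => (L.R.B i : ℂ)) i) a + (SH.altSum ω).mulVec x₀ i)
    (hd : Real.cos (ω * a + (L.KSR ω RI).arg) = -d) :
    x₀ = d • L.resetState SQ SH ω RI := by
  have h3 : (L.resetMatrix SQ SH ω).mulVec x₀ =
      (d * ‖L.KSR ω RI‖) • ((L.Lam ω)⁻¹).mulVec (ω • L.R.B) := by
    have h4 : (Matrix.replicateCol Unit L.R.B).mulVec ((SQ.altSum ω).mulVec x₀) =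
        (SQ.altSum ω).mulVec x₀ () • L.R.B := by
      funext i
      simp [Matrix.mulVec, dotProduct, mul_comm]
    rw [Loop.resetMatrix, Matrix.sub_mulVec, Matrix.add_mulVec, Matrix.one_mulVec,
      ← Matrix.mulVec_mulVec, ← Matrix.mulVec_mulVec _ _ (Matrix.replicateCol Unit L.R.B), h4,
      Matrix.mulVec_smul, Matrix.mulVec_smul]
    funext i
    have h5 := h2 i
    -- The sine part is itself linear in `x₀` by `h1` and becomes the rank-one term of
    -- `resetMatrix`; the cosine part, with factor `d`, is the right-hand side.
    rw [Loop.res_mulVec_B hR, sinusoid_mul, hd, h1] at h5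
    simp only [Pi.sub_apply, Pi.add_apply, Pi.smul_apply, smul_eq_mul]
    linear_combination h5
  have h4 := congrArg (L.resetMatrix SQ SH ω)⁻¹.mulVec h3
  rw [Matrix.mulVec_mulVec, Matrix.nonsing_inv_mul _ hM, Matrix.one_mulVec, Matrix.mulVec_smul,
    Matrix.mulVec_mulVec] at h4
  rw [h4, Loop.resetState, smul_smul]

/-- The half-wave symmetric error response in terms of the state at a descending reset. -/
theorem Loop.errorResponse_eq {L : Loop k r c p} {ω : ℝ} (hω : 0 < ω) {RI : ℂ}
    (hκ : ‖L.KSR ω RI‖ ≠ 0) (hΛ : IsUnit (L.Lam ω).det) (hΔ : IsUnit (L.Del ω).det)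
    (hΔD : IsUnit (L.DelD ω).det) {SQ : Realization σ Unit r} {a : ℝ} {x₀ : r → ℝ} {n : ℕ}
    (hexp : Odd n → Complex.exp (-(Complex.I * n * (ω * a + (L.KSR ω RI).arg : ℝ))) =
      -Complex.exp (Complex.I * n * L.Φ SQ ω RI x₀)) :
    L.errorResponse SQ ω RI x₀ n = (if n = 1 then L.SL (Complex.I * ω) * RI else 0) -
      (if Odd n then L.SL (Complex.I * n * ω) * (L.G (Complex.I * n * ω) *
        (2 * Complex.I * ω / Real.pi * Complex.exp (-(Complex.I * n * ω * a)) *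
        (L.Rδ (Complex.I * n * ω)).mulVec (fun i => (x₀ i : ℂ)) ())) else 0) := by
  have h1 : L.resetPart SQ ω RI x₀ n = if Odd n then L.SL (Complex.I * n * ω) *
      (L.G (Complex.I * n * ω) *
        (2 * Complex.I * ω / Real.pi * Complex.exp (-(Complex.I * n * ω * a)) *
        (L.Rδ (Complex.I * n * ω)).mulVec (fun i => (x₀ i : ℂ)) ())) else 0 := by
    split_ifs with hn
    · have h2 := Loop.RstarDF_Bstar hω.ne' hκ hΛ hΔ hΔD x₀ hn
      have h3 : Complex.exp (-(Complex.I * n * ω * a)) =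
          -Complex.exp (Complex.I * n * ((L.KSR ω RI).arg + L.Φ SQ ω RI x₀ : ℝ)) := by
        have e1 : -(Complex.I * n * ω * a) =
            -(Complex.I * n * (ω * a + (L.KSR ω RI).arg : ℝ)) +
              Complex.I * n * (L.KSR ω RI).arg := by
          push_cast
          ring
        have e2 : Complex.I * n * ((L.KSR ω RI).arg + L.Φ SQ ω RI x₀ : ℝ) =
            Complex.I * n * L.Φ SQ ω RI x₀ + Complex.I * n * (L.KSR ω RI).arg := by
          push_cast
          ring
        rw [e1, e2, Complex.exp_add, Complex.exp_add, hexp hn, neg_mul]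
      rw [Loop.resetPart, Loop.Psi, h3]
      linear_combination L.SL (Complex.I * n * ω) * L.G (Complex.I * n * ω) *
        Complex.exp (Complex.I * n * ((L.KSR ω RI).arg + L.Φ SQ ω RI x₀ : ℝ)) * h2
    · rw [Loop.resetPart, Loop.RstarDF, if_neg hn]
      ring
  rw [Loop.errorResponse, ← h1]
  split_ifs with hn
  · rw [hn]
  · rw [zero_sub]

theorem Loop.norm_errorResponse_smul_sub (L : Loop k r c p) (SQ : Realization σ Unit r) (ω : ℝ)
    (RI : ℂ) (d : ℝ) (x : r → ℝ) (n : ℕ) :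
    ‖L.errorResponse SQ ω RI (d • x) n - L.errorResponse SQ ω RI x n‖ =
      ‖L.resetPart SQ ω RI x n‖ * ‖(d : ℂ) * Complex.exp (Complex.I * n * L.Φ SQ ω RI (d • x)) -
        Complex.exp (Complex.I * n * L.Φ SQ ω RI x)‖ := by
  rw [← L.norm_resetPart_smul_sub, norm_sub_rev (L.resetPart SQ ω RI (d • x) n)]
  congr 1
  rw [Loop.errorResponse, Loop.errorResponse]
  split_ifs with hn
  · rw [hn]
    ring
  · ring

end SteadyState

end ResetControl

end

/-! ### The exact solution and its approximation -/

theorem mainTheorem5 {k r c p σ τ : Type*}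
    [Fintype k] [DecidableEq k] [Fintype r] [DecidableEq r] [Fintype c] [DecidableEq c]
    [Fintype p] [DecidableEq p] [Fintype σ] [DecidableEq σ] [Fintype τ] [DecidableEq τ]
    (L : ResetControl.Loop k r c p) (ω : ℝ) (hω : 0 < ω) (RI : ℂ) (hRI : RI ≠ 0)
    (hwp : L.WellPosed)
    -- no harmonic of the reference frequency is a pole
    (hreg : ∀ n : ℕ, 1 ≤ n → L.RegularAt (Complex.I * n * ω))
    -- stable state-space matrices of `Q_δ` and `H`
    (SQ : ResetControl.Realization σ Unit r) (hSQ : L.Realizes SQ L.Qδ)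
    (hSQ_stable : ResetControl.Hurwitz SQ.A)
    (SH : ResetControl.Realization τ r r) (hSH : L.Realizes SH L.H)
    (hSH_stable : ResetControl.Hurwitz SH.A)
    -- the inverted terms are invertible
    (hΔ : IsUnit (L.Del ω).det) (hΔD : IsUnit (L.DelD ω).det)
    (hM : IsUnit (L.resetMatrix SQ SH ω).det)
    -- `z` is the steady-state response to the reference with phasor `RI`
    (z : ResetControl.Signals k r c p) (hz : L.IsSteadyState ω RI z)
    (hz_unique : ∀ z', L.IsSteadyState ω RI z' → z' = z)
    -- exactly two resets per period
    (htwo : {t ∈ Set.Ico (0 : ℝ) (2 * Real.pi / ω) | z.q t = 0}.ncard = 2)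
    -- zero crossing direction as in the base linear system
    (hdir : ∀ t, z.q t = 0 → SignType.sign (derivWithin z.q (Set.Iic t) t) =
      SignType.sign (deriv (ResetControl.sinusoid ω (L.KSR ω RI)) t))
    -- at a reset, the impulse responses of all prior resets stay below the peak of the base
    -- linear response
    (hprior : ∀ t, z.q t = 0 →
      |∑' s : {s : ℝ // s < t ∧ z.q s = 0}, (SQ.impulse (t - s)).mulVec (z.xR s) ()| <
        ‖L.KSR ω RI‖) :
    -- exact solution in terms of the actual state at the descending reset
    (∃ t, ResetControl.Loop.IsDescendingReset z t) ∧
    (∀ t, ResetControl.Loop.IsDescendingReset z t →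
      z.xR t = Real.cos (L.Φ SQ ω RI (z.xR t)) • L.resetState SQ SH ω RI ∧
      ∀ n : ℕ, 1 ≤ n →
        ResetControl.harmonic ω n z.e = L.errorResponse SQ ω RI (z.xR t) n ∧
        L.sensitivity ω n =
          L.errorResponse SQ ω RI (z.xR t) n * (ResetControl.refPhasor RI n)⁻¹ ∧
        L.compSensitivity ω n = ResetControl.idHarmonic n -
          L.errorResponse SQ ω RI (z.xR t) n * (ResetControl.refPhasor RI n)⁻¹ ∧
        (L.P.tf (Complex.I * n * ω) ≠ 0 →
          L.controlSensitivity ω n = (L.P.tf (Complex.I * n * ω))⁻¹ *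
            (ResetControl.idHarmonic n -
              L.errorResponse SQ ω RI (z.xR t) n * (ResetControl.refPhasor RI n)⁻¹))) ∧
    -- analytical solution in terms of the analytical reset state, with its error for small `Φ`
    (∀ n : ℕ, 1 ≤ n → ∀ x : r → ℝ, x = L.resetState SQ SH ω RI → ∀ ε : ℝ,
      ε = ‖L.resetPart SQ ω RI x n‖ *
        ((L.Φ SQ ω RI x ^ 2 + n * |L.Φ SQ ω RI x| ^ 3) / 2) →
        ‖ResetControl.harmonic ω n z.e - L.errorResponse SQ ω RI x n‖ ≤ ε ∧
        ‖L.sensitivity ω n -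
          L.errorResponse SQ ω RI x n * (ResetControl.refPhasor RI n)⁻¹‖ ≤ ε / ‖RI‖ ∧
        ‖L.compSensitivity ω n - (ResetControl.idHarmonic n -
          L.errorResponse SQ ω RI x n * (ResetControl.refPhasor RI n)⁻¹)‖ ≤ ε / ‖RI‖ ∧
        (L.P.tf (Complex.I * n * ω) ≠ 0 →
          ‖L.controlSensitivity ω n - (L.P.tf (Complex.I * n * ω))⁻¹ *
            (ResetControl.idHarmonic n -
              L.errorResponse SQ ω RI x n * (ResetControl.refPhasor RI n)⁻¹)‖ ≤
            ε / (‖RI‖ * ‖L.P.tf (Complex.I * n * ω)‖))) := by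
  open ResetControl in
  have hpos : 0 < Real.pi / ω := by positivity
  have hsym := hz.transform_neg_one hω hz_unique
  have anti_q : ∀ t, z.q (t + Real.pi / ω) = -z.q t := add_half_eq_neg (congrArg Signals.q hsym)
  have anti_R := add_half_eq_neg (congrArg Signals.xR hsym)
  have hgap : ∀ a s, z.q a = 0 → s ∈ Ioo a (a + Real.pi / ω) → z.q s ≠ 0 := fun a s ha hs =>
    not_zero_of_ncard_eq_two hpos anti_q (by rw [← mul_div_assoc]; exact htwo) ha hs
  have hR1 : L.RegularAt (Complex.I * ω) := by
    have := hreg 1 le_rfl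
    rwa [Nat.cast_one, mul_one] at this
  have hΛ := Loop.isUnit_det_Lam hR1.2.1
  -- the half-period after a reset
  have hhalf : ∀ a, z.q a = 0 → ∃ z',
      L.IsHalfPeriod (sinusoid ω RI) a (a + Real.pi / ω) (z.xR a) z' ∧
      ∀ t ∈ Ioc a (a + Real.pi / ω), z'.xR t = z.xR t ∧ z'.e t = z.e t ∧ z'.q t = z.q t ∧
        z'.u t = z.u t ∧ z'.y t = z.y t := fun a ha =>
    hz.response.isHalfPeriod hwp (continuous_sinusoid ω RI) (lt_add_of_pos_right a hpos) ha
      (fun t ht => hgap a t ha ht) (add_half_eq_neg (congrArg Signals.xK hsym) a) (anti_R a)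
      (add_half_eq_neg (congrArg Signals.xC hsym) a) (add_half_eq_neg (congrArg Signals.xP hsym) a)
  have hmem : ∀ a, a + Real.pi / ω ∈ Ioc a (a + Real.pi / ω) := fun a =>
    ⟨lt_add_of_pos_right a hpos, le_rfl⟩
  have hreset : ∀ a, z.q a = 0 →
      sinusoid ω (L.KSR ω RI) a = (SQ.altSum ω).mulVec (z.xR a) () ∧
      ∀ i, z.xR a i = sinusoid ω (L.KSR ω RI *
        (L.R.res (Complex.I * ω)).mulVec (fun i => (L.R.B i : ℂ)) i) a +
          (SH.altSum ω).mulVec (z.xR a) i := by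
    intro a ha
    obtain ⟨z', hz', heq⟩ := hhalf a ha
    refine hz'.reset_equations hω hreg hSQ hSQ_stable hSH hSH_stable ?_
    rw [(heq _ (hmem a)).2.2.1, anti_q, ha, neg_zero]
  -- the direction of the zero crossings
  have hderiv : ∀ t, deriv (sinusoid ω (L.KSR ω RI)) t =
      ‖L.KSR ω RI‖ * (Real.cos (ω * t + (L.KSR ω RI).arg) * ω) := by
    intro t
    have h1 : HasDerivAt (fun t => ω * t + (L.KSR ω RI).arg) ω t := by
      simpa using ((hasDerivAt_id t).const_mul ω).add_const (L.KSR ω RI).arg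
    exact (h1.sin.const_mul _).deriv
  obtain ⟨a₀, ha₀⟩ : ∃ a, z.q a = 0 := by
    obtain ⟨a, -, ha⟩ := Set.nonempty_of_ncard_ne_zero (htwo.trans_ne two_ne_zero)
    exact ⟨a, ha⟩
  have hκ : 0 < ‖L.KSR ω RI‖ := (abs_nonneg _).trans_lt (hprior a₀ ha₀)
  have hdesc : ∀ a, z.q a = 0 →
      (derivWithin z.q (Iic a) a < 0 ↔ Real.cos (ω * a + (L.KSR ω RI).arg) < 0) := by
    intro a ha
    rw [← sign_eq_neg_one_iff, hdir a ha, sign_eq_neg_one_iff, hderiv, ← neg_pos,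
      ← mul_neg, mul_pos_iff_of_pos_left hκ, ← neg_mul, mul_pos_iff_of_pos_right hω, neg_pos]
  have hex : ∃ t, Loop.IsDescendingReset z t := by
    -- The sum over prior resets equals the base response at `a₀`, so the sine of the phase there is
    -- strictly below one in modulus and the cosine is nonzero. It is negative either at `a₀` or
    -- half a period later.
    have hsum := hprior a₀ ha₀
    rw [tsum_impulse_eq_altSum hSQ_stable hω anti_q anti_R hgap ha₀, ← (hreset a₀ ha₀).1, sinusoid,
      abs_mul, abs_norm, mul_lt_iff_lt_one_right hκ] at hsum
    rcases lt_trichotomy (Real.cos (ω * a₀ + (L.KSR ω RI).arg)) 0 with h | h | h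
    · exact ⟨a₀, ha₀, (hdesc a₀ ha₀).2 h⟩
    · have h1 := Real.sin_sq_add_cos_sq (ω * a₀ + (L.KSR ω RI).arg)
      rw [h, ← sq_abs] at h1
      nlinarith [abs_nonneg (Real.sin (ω * a₀ + (L.KSR ω RI).arg))]
    · have hq : z.q (a₀ + Real.pi / ω) = 0 := by rw [anti_q, ha₀, neg_zero]
      refine ⟨a₀ + Real.pi / ω, hq, (hdesc _ hq).2 ?_⟩
      rw [show ω * (a₀ + Real.pi / ω) + (L.KSR ω RI).arg =
        ω * a₀ + (L.KSR ω RI).arg + Real.pi by field_simp; ring, Real.cos_add_pi]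
      linarith
  -- the exact solution at a descending reset
  have hmain : ∀ t, Loop.IsDescendingReset z t →
      Real.sin (L.Φ SQ ω RI (z.xR t)) = (SQ.altSum ω).mulVec (z.xR t) () * ‖L.KSR ω RI‖⁻¹ ∧
      0 < Real.cos (L.Φ SQ ω RI (z.xR t)) ∧
      z.xR t = Real.cos (L.Φ SQ ω RI (z.xR t)) • L.resetState SQ SH ω RI ∧
      ∀ n : ℕ, 1 ≤ n → ResetControl.harmonic ω n z.e = L.errorResponse SQ ω RI (z.xR t) n := by
    rintro a ⟨ha, hda⟩
    have hc := (hdesc a ha).1 hda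
    obtain ⟨h1, h2⟩ := hreset a ha
    have hs : Real.sin (ω * a + (L.KSR ω RI).arg) =
        (SQ.altSum ω).mulVec (z.xR a) () * ‖L.KSR ω RI‖⁻¹ := by
      rw [← h1, sinusoid]
      field_simp
    obtain ⟨h3, h4⟩ := cos_arcsin_of_cos_neg hs hc
    refine ⟨h3, ?_, Loop.eq_cos_smul_resetState hR1.2.1 hM h1 h2 h4, fun n hn => ?_⟩
    · change 0 < Real.cos (Real.arcsin _)
      linarith
    · obtain ⟨z', hz', heq⟩ := hhalf a ha
      rw [(hz'.harmonic_eq hω hsym heq hn (hreg n hn)).1]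
      exact (Loop.errorResponse_eq hω hκ.ne' hΛ hΔ hΔD
        fun ho => exp_of_cos_neg (hs.trans h3.symm) h4 ho).symm
  -- the sensitivities in terms of the harmonics of the error
  have hper : ∀ {f : ℝ → ℝ}, (fun t => -1 * f (t + Real.pi / ω)) = f →
      Function.Periodic f (2 * Real.pi / ω) := fun {f} h t => by
    have h1 : ∀ t, -1 * f (t + Real.pi / ω) = f t := fun t => congrFun h t
    rw [show t + 2 * Real.pi / ω = t + Real.pi / ω + Real.pi / ω by ring]
    linarith [h1 t, h1 (t + Real.pi / ω)]
  have href : ∀ n, refPhasor RI n ≠ 0 := fun n => by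
    rw [← norm_ne_zero_iff, norm_refPhasor]
    exact norm_ne_zero_iff.2 hRI
  have hss := hz.steadyState_one hω hRI hz_unique
  have hS : ∀ n, L.sensitivity ω n = ResetControl.harmonic ω n z.e * (refPhasor RI n)⁻¹ := by
    intro n
    rw [Loop.sensitivity, hss]
    exact harmonic_transform hω (hper (congrArg Signals.e hsym)) n
  have hyu : ∀ n, 1 ≤ n →
      ResetControl.harmonic ω n z.y =
        idHarmonic n * refPhasor RI n - ResetControl.harmonic ω n z.e ∧
      ResetControl.harmonic ω n z.y =
        L.P.tf (Complex.I * n * ω) * ResetControl.harmonic ω n z.u := fun n hn => by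
    obtain ⟨z', hz', heq⟩ := hhalf a₀ ha₀
    exact (hz'.harmonic_eq hω hsym heq hn (hreg n hn)).2
  have hT : ∀ n, 1 ≤ n → L.compSensitivity ω n =
      idHarmonic n - ResetControl.harmonic ω n z.e * (refPhasor RI n)⁻¹ := fun n hn => by
    rw [Loop.compSensitivity, hss]
    refine (harmonic_transform hω (hper (congrArg Signals.y hsym)) n).trans ?_
    rw [(hyu n hn).1, sub_mul, mul_inv_cancel_right₀ (href n)]
  have hCS : ∀ n : ℕ, 1 ≤ n → L.P.tf (Complex.I * n * ω) ≠ 0 → L.controlSensitivity ω n =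
      (L.P.tf (Complex.I * n * ω))⁻¹ *
        (idHarmonic n - ResetControl.harmonic ω n z.e * (refPhasor RI n)⁻¹) := fun n hn hP => by
    rw [← hT n hn, Loop.controlSensitivity, Loop.compSensitivity, hss]
    have h1 := harmonic_transform (RI := RI) hω (hper (congrArg Signals.y hsym)) n
    have h2 := harmonic_transform (RI := RI) hω (hper (congrArg Signals.u hsym)) n
    refine h2.trans ?_
    rw [eq_inv_mul_iff_mul_eq₀ hP, ← mul_assoc, ← (hyu n hn).2]
    exact h1.symm
  refine ⟨hex, fun t ht => ?_, fun n hn x hx ε hε => ?_⟩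
  · obtain ⟨-, -, h1, h2⟩ := hmain t ht
    refine ⟨h1, fun n hn => ?_⟩
    rw [← h2 n hn]
    exact ⟨rfl, hS n, hT n hn, hCS n hn⟩
  · obtain ⟨t, ht⟩ := hex
    obtain ⟨h1, h2, h3, h4⟩ := hmain t ht
    rw [← hx] at h3
    have hE : ‖ResetControl.harmonic ω n z.e - L.errorResponse SQ ω RI x n‖ ≤ ε := by
      set d := Real.cos (L.Φ SQ ω RI (z.xR t)) with hd
      rw [h4 n hn, h3, L.norm_errorResponse_smul_sub, hε]
      refine mul_le_mul_of_nonneg_left ?_ (norm_nonneg _)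
      rw [← h3]
      have hb := Real.arcsin_mem_Icc ((SQ.altSum ω).mulVec (z.xR t) () * ‖L.KSR ω RI‖⁻¹)
      refine norm_cos_mul_exp_sub_exp_le ?_ ?_ ?_ hn
      -- The sine at the true state is linear in that state, which is `d` times the analytical one,
      -- and `d` is the cosine: hence the tangent is the argument of the arcsine at `x`.
      · rw [Real.tan_eq_sin_div_cos, h1, ← hd, div_eq_iff h2.ne']
        nth_rewrite 1 [h3]
        rw [Matrix.mulVec_smul, Pi.smul_apply, smul_eq_mul]
        ring
      · refine lt_of_le_of_ne hb.1 fun h => h2.ne' ?_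
        rw [hd, show L.Φ SQ ω RI (z.xR t) = -(Real.pi / 2) from h.symm, Real.cos_neg,
          Real.cos_pi_div_two]
      · refine lt_of_le_of_ne hb.2 fun h => h2.ne' ?_
        rw [hd, show L.Φ SQ ω RI (z.xR t) = Real.pi / 2 from h, Real.cos_pi_div_two]
    have hE' : ‖ResetControl.harmonic ω n z.e * (refPhasor RI n)⁻¹ -
        L.errorResponse SQ ω RI x n * (refPhasor RI n)⁻¹‖ ≤ ε / ‖RI‖ := by
      rw [← sub_mul, norm_mul, norm_inv, norm_refPhasor, div_eq_mul_inv]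
      gcongr
    refine ⟨hE, ?_, ?_, fun hP => ?_⟩
    · rw [hS]
      exact hE'
    · rw [hT n hn, sub_sub_sub_cancel_left, norm_sub_rev]
      exact hE'
    · rw [hCS n hn hP, ← mul_sub, sub_sub_sub_cancel_left, norm_mul, norm_inv, norm_sub_rev,
        ← div_div, div_eq_inv_mul _ ‖L.P.tf _‖]
      gcongr
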